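/- Let $\alpha\in(0,1)$, $\rho>0$, $\omega,\gamma\in\mathbb R$, $L,T>0$. Write $E_{\rho,\beta}^{\kappa}(z)=\sum_{m\ge 0}\frac{(\kappa)_m z^m}{\Gamma(\rho m+\beta)\,m!}$, where $(\kappa)_m=\kappa(\kappa+1)\cdots(\kappa+m-1)$, and let $$D_t g(t)=\int_0^t (t-s)^{-\alpha}E_{\rho,1-\alpha}^{-\gamma}(\omega(t-s)^\rho)\,g'(s)\,ds$$ be the Caputo–Prabhakar derivative. Let $f$ be continuous on $[0,L]\times[0,T]$, and let $v\in C^4([0,L]\times[0,T])$ satisfy $$D_t v+v\,v_x=v_{xx}+f \ \text{ in }(0,L)\times(0,T),\qquad v(x,0)=\phi(x)\ (0<x<L),\qquad v(0,t)=v(L,t)=0\ (0<t<T).$$ Let $C_0$ be a constant with $|v_x|\le C_0$ on $(0,L)\times[0,T]$. For integers $N,M\ge 1$ put $\tau=T/N$, $h=L/M$, $t_k=k\tau$, $x_i=ih$, $\mu=\tau^\alpha$ and $$a_n=n^{1-\alpha}E_{\rho,2-\alpha}^{-\gamma}(\omega t_n^\rho)-(n-1)^{1-\alpha}E_{\rho,2-\alpha}^{-\gamma}(\omega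 t_{n-1}^\rho),\qquad 1\le n\le N .$$ Let $(u_i^k)_{0\le i\le M,\,0\le k\le N}$ be any solution of the difference scheme $$\frac1\mu\Big[a_1u_i^k-\sum_{j=1}^{k-1}(a_{k-j}-a_{k-j+1})u_i^j-a_ku_i^0\Big]+\frac1{6h}\big(u_i^k\Delta u_i^k+\Delta (u_i^k)^2\big)=\delta_x^2u_i^k+f(x_i,t_k)$$ for $1\le i\le M-1$, $1\le k\le N$, with $u_0^k=u_M^k=0$ $(0\le k\le N)$ and $u_i^0=\phi(x_i)$ $(1\le i\le M-1)$, where $\Delta w_i=w_{i+1}-w_{i-1}$ and $\delta_x^2w_i=(w_{i+1}-2w_i+w_{i-1})/h^2$. Put $\varepsilon_i^k=v(x_i,t_k)-u_i^k$, $\delta_xw_i=(w_i-w_{i-1})/h$ and $\|\delta_x w\|_h^2=\sum_{i=1}^{M}h(\delta_xw_i)^2$. **Theorem.** There is a constant $C>0$, independent of $N$, $M$ and of the discrete solution, such that for all $N,M\ge1$ with $$a_1>0\qquad\text{and}\qquad \frac{a_N}{2\mu}-\frac{C_0}{2}>0$$ every solution of the scheme satisfies $$\tau\sum_{k=1}^N\|\delta_x\varepsilon^k\|_h^2\le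 C\,(\tau^{2-\alpha}+h^2)^2 \qquad\text{and}\qquad \Big(\tau\sum_{k=1}^N\|\delta_x\varepsilon^k\|_h^2\Big)^{1/2}\le C\,(\tau^{2-\alpha}+h^2),$$ that is, the scheme converges with order $2-\alpha$ in time and $2$ in space. -/

import Mathlib

open Set

noncomputable section

namespace CPBurgers

/-- The three-parameter Mittag-Leffler (Prabhakar) function `E_{ρ,β}^{γ}(z)` for real parameters.
The quotient `Γ(γ+m)/Γ(γ)` is the Pochhammer symbol `(γ)_m = γ(γ+1)⋯(γ+m-1)`, which also makes
sense when `γ` is a pole of the Gamma function. -/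
def prabhakar (ρ β γ z : ℝ) : ℝ :=
  ∑' m : ℕ, (ascPochhammer ℝ m).eval γ * z ^ m / (Real.Gamma (ρ * m + β) * (m.factorial : ℝ))

/-- The Caputo--Prabhakar derivative
`∫₀ᵗ (t-s)^{-α} E_{ρ,1-α}^{-γ}(ω (t-s)^ρ) g'(s) ds`. -/
def cpDeriv (ρ α ω γ : ℝ) (g : ℝ → ℝ) (t : ℝ) : ℝ :=
  ∫ s in (0 : ℝ)..t,
    (t - s) ^ (-α) * prabhakar ρ (1 - α) (-γ) (ω * (t - s) ^ ρ) * deriv g s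

/-- `v = v(x,t)` satisfies the time-fractional Burgers equation
`D_t v + v v_x = v_xx + f` on `(0,L) × (0,T)`, with `v(x,0) = φ(x)` and
homogeneous Dirichlet boundary conditions. -/
structure IsExactSolution (ρ α ω γ L T : ℝ) (f : ℝ → ℝ → ℝ) (φ : ℝ → ℝ) (v : ℝ → ℝ → ℝ) :
    Prop where
  equation : ∀ x ∈ Ioo 0 L, ∀ t ∈ Ioo 0 T,
    cpDeriv ρ α ω γ (fun s => v x s) t + v x t * deriv (fun y => v y t) x
      = iteratedDeriv 2 (fun y => v y t) x + f x t
  initial : ∀ x ∈ Ioo 0 L, v x 0 = φ x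
  boundary : ∀ t ∈ Ioo 0 T, v 0 t = 0 ∧ v L t = 0

/-- The coefficients
`a_n = n^{1-α} E_{ρ,2-α}^{-γ}(ω t_n^ρ) - (n-1)^{1-α} E_{ρ,2-α}^{-γ}(ω t_{n-1}^ρ)`, `n ≥ 1`,
where `t_n = n τ`. -/
def coeff (ρ α ω γ τ : ℝ) (n : ℕ) : ℝ :=
  (n : ℝ) ^ (1 - α) * prabhakar ρ (2 - α) (-γ) (ω * ((n : ℝ) * τ) ^ ρ)
    - ((n : ℝ) - 1) ^ (1 - α) * prabhakar ρ (2 - α) (-γ) (ω * (((n : ℝ) - 1) * τ) ^ ρ)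

/-- The discrete Caputo--Prabhakar derivative at time level `k`,
`(1/μ) [a_1 y^k - ∑_{j=1}^{k-1} (a_{k-j} - a_{k-j+1}) y^j - a_k y^0]`, with `μ = τ^α`. -/
def discreteCP (ρ α ω γ τ : ℝ) (y : ℕ → ℝ) (k : ℕ) : ℝ :=
  1 / τ ^ α * (coeff ρ α ω γ τ 1 * y k
    - ∑ j ∈ Finset.Icc 1 (k - 1),
        (coeff ρ α ω γ τ (k - j) - coeff ρ α ω γ τ (k - j + 1)) * y j
    - coeff ρ α ω γ τ k * y 0)

/-- The undivided central difference `Δ w_i = w_{i+1} - w_{i-1}`, for `i ≥ 1`. -/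
def centralDiff (w : ℕ → ℝ) (i : ℕ) : ℝ := w (i + 1) - w (i - 1)

/-- The second difference `δ_x² w_i = (w_{i+1} - 2 w_i + w_{i-1}) / h²`, for `i ≥ 1`. -/
def secondDiff (h : ℝ) (w : ℕ → ℝ) (i : ℕ) : ℝ := (w (i + 1) - 2 * w i + w (i - 1)) / h ^ 2

/-- The backward difference `δ_x w_i = (w_i - w_{i-1}) / h`, for `i ≥ 1`. -/
def backwardDiff (h : ℝ) (w : ℕ → ℝ) (i : ℕ) : ℝ := (w i - w (i - 1)) / h

/-- The squared grid norm `‖w‖_h² = ∑_{i=1}^{M} h w_i²`. For grid functions with `w_M = 0` the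
last term vanishes; for `w = δ_x z` all `M` backward differences are counted. -/
def gridNormSq (h : ℝ) (M : ℕ) (w : ℕ → ℝ) : ℝ := ∑ i ∈ Finset.Icc 1 M, h * w i ^ 2

/-- `u k i = u_i^k` solves the implicit difference scheme on the mesh `τ = T/N`, `h = L/M`. -/
structure IsSchemeSolution (ρ α ω γ L T : ℝ) (f : ℝ → ℝ → ℝ) (φ : ℝ → ℝ) (N M : ℕ)
    (u : ℕ → ℕ → ℝ) : Prop where
  equation : ∀ k ∈ Finset.Icc 1 N, ∀ i ∈ Finset.Icc 1 (M - 1),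
    discreteCP ρ α ω γ (T / N) (fun j => u j i) k
      + 1 / (6 * (L / M)) * (u k i * centralDiff (u k) i + centralDiff (fun l => u k l ^ 2) i)
      = secondDiff (L / M) (u k) i + f (i * (L / M)) (k * (T / N))
  boundary : ∀ k ≤ N, u k 0 = 0 ∧ u k M = 0
  initial : ∀ i ∈ Finset.Icc 1 (M - 1), u 0 i = φ (i * (L / M))

/-- The error `ε_i^k = v(x_i, t_k) - u_i^k` on the mesh with steps `τ` and `h`. -/
def gridError (τ h : ℝ) (v : ℝ → ℝ → ℝ) (u : ℕ → ℕ → ℝ) (k i : ℕ) : ℝ :=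
  v (i * h) (k * τ) - u k i

/-- The squared error `τ ∑_{k=1}^N ‖δ_x ε^k‖_h²` on the mesh `τ = T/N`, `h = L/M`. -/
def errorSq (L T : ℝ) (N M : ℕ) (v : ℝ → ℝ → ℝ) (u : ℕ → ℕ → ℝ) : ℝ :=
  T / N * ∑ k ∈ Finset.Icc 1 N,
    gridNormSq (L / M) M (backwardDiff (L / M) (gridError (T / N) (L / M) v u k))

end CPBurgers

end

/-! The proof is an energy argument for the error, with a geometric weight in time in place of
monotonicity of the `a_n`, which may fail because `ω` and `γ` have arbitrary signs.

Write `A_n = a_n / μ`. By `coeff_eq` this is the mean over the `n`-th time cell of the kernel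
`t^{-α} E_{ρ,1-α}^{-γ}(ω t^ρ)`. On sequences with zero initial value the discrete derivative is the
Volterra operator `A_1 y^k - ∑ b_{k-j} y^j` with `b_n = A_n - A_{n+1}`. Tested against `q^{2k} y^k`
it is coercive with constant `A_1 - ∑ |b_n| q^n` (`weighted_coercivity`). In space, the convective
form `w Δw + Δ(w²)` leaves, after summation, only terms quadratic in the error whose coefficients
are differences of `v` (`convection_energy`). They cost `C₀/2` times the squared norm of the error,
with no bound on `u`.

Fine meshes (`exists_weight_of_fine`): near `0` the kernel is decreasing and as large as desired, so
the first `|b_n|` telescope to `A_1 - A_m` with `A_m` large. Away from `0` one has `|b_n| = O(τ)`,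
and `q = exp(-lτ)` with `l` large makes the tail at most `1`. The coercivity constant thus exceeds
`C₀/2` by a full unit, while `q^{2N} = exp(-2lT)` does not depend on the mesh. With the consistency
error `O(τ^{2-α} + h²)` of `exists_consistency_bound` this gives the estimate.

Coarse meshes: only finitely many `N` remain, and for each of them `τ^{2-α}` is a positive constant,
so a bound uniform in `M` is enough. The energy of `u` itself gives it: the convection then
contributes nothing, and `a_1 > 0` yields coercivity for small `q` (`exists_errorSq_bound`). -/

noncomputable section

namespace CPBurgers

open Filter Topology MeasureTheory

/-! ### Entire power series -/

/-- The coefficients of an everywhere convergent power series. -/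
def EntireCoeff (d : ℕ → ℝ) : Prop := ∀ R : ℝ, 0 ≤ R → Summable fun m => |d m| * R ^ m

lemma EntireCoeff.summable {d : ℕ → ℝ} (hd : EntireCoeff d) (z : ℝ) :
    Summable fun m => d m * z ^ m := by
  refine Summable.of_norm ((hd |z| (abs_nonneg z)).congr fun m => ?_)
  rw [Real.norm_eq_abs, abs_mul, abs_pow]

/-- Since `m ≤ 2^m`, the factor `m` costs no more than doubling the radius. -/
lemma EntireCoeff.natMul {d : ℕ → ℝ} (hd : EntireCoeff d) :
    EntireCoeff fun m => (m : ℝ) * d m := by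
  intro R hR
  refine Summable.of_nonneg_of_le (fun m => by positivity) (fun m => ?_)
    (hd (2 * R) (by positivity))
  have h : (m : ℝ) ≤ 2 ^ m := by exact_mod_cast (Nat.lt_two_pow_self).le
  calc |(m : ℝ) * d m| * R ^ m = m * (|d m| * R ^ m) := by
        rw [abs_mul, Nat.abs_cast]; ring
    _ ≤ 2 ^ m * (|d m| * R ^ m) := by gcongr
    _ = |d m| * (2 * R) ^ m := by rw [mul_pow]; ring

lemma EntireCoeff.succ {d : ℕ → ℝ} (hd : EntireCoeff d) : EntireCoeff fun m => d (m + 1) := by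
  intro R hR
  have h := (summable_nat_add_iff 1).2 (hd (R + 1) (by positivity))
  refine Summable.of_nonneg_of_le (fun m => by positivity) (fun m => ?_) h
  have h1 : R ^ m ≤ (R + 1) ^ (m + 1) :=
    (pow_le_pow_left₀ hR (by linarith) m).trans (pow_le_pow_right₀ (by linarith) (by omega))
  gcongr

lemma EntireCoeff.hasDerivAt {d : ℕ → ℝ} (hd : EntireCoeff d) (z : ℝ) :
    HasDerivAt (fun y => ∑' m, d m * y ^ m) (∑' m, (((m + 1 : ℕ) : ℝ) * d (m + 1)) * z ^ m) z := by
  set R := |z| + 1 with hR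
  have hR1 : 1 ≤ R := by have := abs_nonneg z; linarith
  have hu : Summable fun m : ℕ => |(m : ℝ) * d m| * R ^ m := hd.natMul R (by linarith)
  have key := hasDerivAt_tsum_of_isPreconnected (𝕜 := ℝ) (g := fun m y => d m * y ^ m)
    (g' := fun m y => d m * (m * y ^ (m - 1))) (t := Metric.ball (0 : ℝ) R) (y₀ := 0) (y := z)
    hu Metric.isOpen_ball (convex_ball _ _).isPreconnected
    (fun n y _ => (hasDerivAt_pow n y).const_mul (d n))
    (fun n y hy => by
      have hy' : |y| ≤ R := by
        rw [mem_ball_zero_iff] at hy; exact hy.le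
      rw [Real.norm_eq_abs, ← mul_assoc, abs_mul, abs_pow, mul_comm (d n)]
      refine mul_le_mul_of_nonneg_left ?_ (abs_nonneg _)
      exact (pow_le_pow_left₀ (abs_nonneg _) hy' _).trans (pow_le_pow_right₀ hR1 (by omega)))
    (Metric.mem_ball_self (by linarith)) (hd.summable 0)
    (by rw [mem_ball_zero_iff, Real.norm_eq_abs]; linarith)
  have hs : Summable fun m : ℕ => d m * (m * z ^ (m - 1)) := by
    rw [← summable_nat_add_iff 1]
    refine ((hd.natMul.succ).summable z).congr fun m => ?_
    simp; ring
  have : (∑' m, (((m + 1 : ℕ) : ℝ) * d (m + 1)) * z ^ m)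
      = ∑' m : ℕ, d m * (m * z ^ (m - 1)) := by
    rw [hs.tsum_eq_zero_add]
    simp only [Nat.cast_zero, zero_mul, mul_zero, zero_add]
    exact tsum_congr fun m => by simp; ring
  rw [this]
  exact key

lemma EntireCoeff.continuous {d : ℕ → ℝ} (hd : EntireCoeff d) :
    Continuous fun y => ∑' m, d m * y ^ m :=
  continuous_iff_continuousAt.2 fun z => (hd.hasDerivAt z).continuousAt

/-- The Euler operator `z d/dz` is diagonal on monomials, which lets the Gamma recurrence be read as
a differential identity. -/
lemma EntireCoeff.mul_deriv {d : ℕ → ℝ} (hd : EntireCoeff d) (z : ℝ) :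
    z * deriv (fun y => ∑' m, d m * y ^ m) z = ∑' m : ℕ, ((m : ℝ) * d m) * z ^ m := by
  rw [(hd.hasDerivAt z).deriv, (hd.natMul.summable z).tsum_eq_zero_add, ← tsum_mul_left]
  simp only [Nat.cast_zero, zero_mul, zero_add]
  exact tsum_congr fun m => by ring

lemma EntireCoeff.continuous_deriv {d : ℕ → ℝ} (hd : EntireCoeff d) :
    Continuous (deriv fun y => ∑' m, d m * y ^ m) := by
  have : (deriv fun y => ∑' m, d m * y ^ m)
      = fun y => ∑' m, (((m + 1 : ℕ) : ℝ) * d (m + 1)) * y ^ m :=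
    funext fun y => (hd.hasDerivAt y).deriv
  rw [this]
  exact hd.natMul.succ.continuous

/-! ### The Prabhakar function -/

/-- Restrict the Gamma integral to `(A, A+1]`. As `A` is free, Gamma outgrows every exponential. -/
lemma rpow_mul_exp_le_Gamma {A x : ℝ} (hA : 0 < A) (hx : 1 ≤ x) :
    A ^ (x - 1) * Real.exp (-(A + 1)) ≤ Real.Gamma x := by
  rw [Real.Gamma_eq_integral (by linarith)]
  have hint := Real.GammaIntegral_convergent (s := x) (by linarith)
  calc A ^ (x - 1) * Real.exp (-(A + 1))
      = ∫ _ in Ioc A (A + 1), A ^ (x - 1) * Real.exp (-(A + 1)) := by simp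
    _ ≤ ∫ t in Ioc A (A + 1), Real.exp (-t) * t ^ (x - 1) := by
        refine setIntegral_mono_on (integrableOn_const (by simp)) (hint.mono_set fun t ht => hA.trans ht.1)
          measurableSet_Ioc fun t ht => ?_
        rw [mul_comm]
        refine mul_le_mul (Real.exp_le_exp.2 (by linarith [ht.2]))
          (Real.rpow_le_rpow hA.le ht.1.le (by linarith)) (by positivity) (by positivity)
    _ ≤ ∫ t in Ioi 0, Real.exp (-t) * t ^ (x - 1) := by
        refine setIntegral_mono_set hint ?_
          (LE.le.eventuallyLE fun t ht => hA.trans ht.1)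
        filter_upwards [ae_restrict_mem measurableSet_Ioi] with t ht
        have : (0 : ℝ) < t := ht
        positivity

lemma abs_ascPochhammer_div_factorial_le (κ : ℝ) (m : ℕ) :
    |(ascPochhammer ℝ m).eval κ| / (m.factorial : ℝ) ≤ (1 + |κ|) ^ m := by
  induction m with
  | zero => simp
  | succ m ih =>
    rw [ascPochhammer_succ_eval, Nat.factorial_succ, abs_mul, pow_succ]
    push_cast
    have h : |κ + m| / ((m : ℝ) + 1) ≤ 1 + |κ| := by
      rw [div_le_iff₀ (by positivity)]
      have h1 := abs_add_le κ (m : ℝ)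
      rw [Nat.abs_cast] at h1
      nlinarith [abs_nonneg κ, (Nat.cast_nonneg m : (0 : ℝ) ≤ m)]
    calc _ = |(ascPochhammer ℝ m).eval κ| / (m.factorial : ℝ) * (|κ + m| / ((m : ℝ) + 1)) := by
          field_simp
      _ ≤ _ := mul_le_mul ih h (by positivity) (by positivity)

/-- The Taylor coefficients of `prabhakar ρ β κ`. -/
def prabhakarCoeff (ρ β κ : ℝ) (m : ℕ) : ℝ :=
  (ascPochhammer ℝ m).eval κ / (Real.Gamma (ρ * m + β) * (m.factorial : ℝ))

lemma prabhakar_eq_tsum (ρ β κ : ℝ) :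
    prabhakar ρ β κ = fun z => ∑' m, prabhakarCoeff ρ β κ m * z ^ m := by
  funext z
  exact tsum_congr fun m => by rw [prabhakarCoeff]; ring

lemma entireCoeff_prabhakarCoeff {ρ β : ℝ} (κ : ℝ) (hρ : 0 < ρ) (hβ : 0 < β) :
    EntireCoeff (prabhakarCoeff ρ β κ) := by
  intro R hR
  -- `A` is chosen with `A^ρ = Q`, so that `1/Γ(ρm+β) ≤ c Q^{-m}`. This absorbs the Pochhammer
  -- growth `(1+|κ|)^m` and `R^m`, and the factor `2` leaves a geometric series.
  set Q := 2 * ((1 + |κ|) * (R + 1)) with hQ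
  have hQ0 : 0 < Q := by positivity
  set A := Q ^ (1 / ρ) with hA
  have hA0 : 0 < A := by positivity
  have hAρ : A ^ ρ = Q := by
    rw [hA, ← Real.rpow_mul hQ0.le, one_div_mul_cancel hρ.ne', Real.rpow_one]
  set c := (A ^ (β - 1) * Real.exp (-(A + 1)))⁻¹ with hc
  have hc0 : 0 < c := by positivity
  refine Summable.of_norm_bounded_eventually_nat (g := fun m => c * (1 / 2 : ℝ) ^ m)
    (summable_geometric_two.mul_left c) ?_
  obtain ⟨m₀, hm₀⟩ := exists_nat_gt (1 / ρ)
  filter_upwards [eventually_ge_atTop m₀] with m hm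
  have hm1 : 1 ≤ ρ * m := by
    have : (m₀ : ℝ) ≤ m := by exact_mod_cast hm
    have h2 : 1 / ρ ≤ m := hm₀.le.trans this
    rw [div_le_iff₀ hρ] at h2
    linarith
  have hG := rpow_mul_exp_le_Gamma hA0 (x := ρ * m + β) (by linarith)
  have hpow : A ^ (ρ * m + β - 1) = Q ^ m * A ^ (β - 1) := by
    rw [show ρ * m + β - 1 = ρ * m + (β - 1) by ring, Real.rpow_add hA0, Real.rpow_mul hA0.le, hAρ,
      Real.rpow_natCast]
  have hG0 : 0 < Real.Gamma (ρ * m + β) := Real.Gamma_pos_of_pos (by linarith)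
  have hGi : (Real.Gamma (ρ * m + β))⁻¹ ≤ c * (Q ^ m)⁻¹ := by
    rw [hc, ← mul_inv]
    refine inv_anti₀ (by positivity) ?_
    rw [hpow] at hG
    linarith
  have hP := abs_ascPochhammer_div_factorial_le κ m
  have hR' : R ^ m ≤ (R + 1) ^ m := pow_le_pow_left₀ hR (by linarith) m
  rw [Real.norm_eq_abs, abs_mul, abs_abs, abs_pow, abs_of_nonneg hR, prabhakarCoeff, abs_div,
    abs_mul, abs_of_pos hG0, Nat.abs_cast]
  calc |(ascPochhammer ℝ m).eval κ| / (Real.Gamma (ρ * m + β) * (m.factorial : ℝ)) * R ^ m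
      = |(ascPochhammer ℝ m).eval κ| / (m.factorial : ℝ) * (Real.Gamma (ρ * m + β))⁻¹ * R ^ m := by
        field_simp
    _ ≤ (1 + |κ|) ^ m * (c * (Q ^ m)⁻¹) * (R + 1) ^ m := by gcongr
    _ = c * (1 / 2 : ℝ) ^ m := by
        rw [hQ, mul_pow, mul_pow, one_div, inv_pow]
        field_simp

section PrabhakarFunction

variable {ρ β : ℝ} (κ : ℝ) (hρ : 0 < ρ) (hβ : 0 < β)
include hρ hβ

lemma differentiable_prabhakar : Differentiable ℝ (prabhakar ρ β κ) := by
  rw [prabhakar_eq_tsum]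
  exact fun z => ((entireCoeff_prabhakarCoeff κ hρ hβ).hasDerivAt z).differentiableAt

lemma continuous_deriv_prabhakar : Continuous (deriv (prabhakar ρ β κ)) := by
  rw [prabhakar_eq_tsum]
  exact (entireCoeff_prabhakarCoeff κ hρ hβ).continuous_deriv

/-- This is `Γ(x+1) = x Γ(x)` at `x = ρm+β`, coefficient by coefficient. It is what makes
`cpKernelPrim` a primitive of `cpKernel`. -/
lemma prabhakar_eq_add_mul_deriv (z : ℝ) :
    prabhakar ρ β κ z
      = β * prabhakar ρ (β + 1) κ z + ρ * (z * deriv (prabhakar ρ (β + 1) κ) z) := by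
  have h1 := entireCoeff_prabhakarCoeff (β := β + 1) κ hρ (by linarith)
  simp only [prabhakar_eq_tsum]
  rw [h1.mul_deriv, ← tsum_mul_left, ← tsum_mul_left,
    ← ((h1.summable z).mul_left β).tsum_add ((h1.natMul.summable z).mul_left ρ)]
  refine tsum_congr fun m => ?_
  have hx : 0 < ρ * m + β := by positivity
  have hG : 0 < Real.Gamma (ρ * m + β) := Real.Gamma_pos_of_pos hx
  have hf : (m.factorial : ℝ) ≠ 0 := by positivity
  rw [prabhakarCoeff, prabhakarCoeff, ← add_assoc, Real.Gamma_add_one hx.ne']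
  field_simp
  ring

end PrabhakarFunction

lemma prabhakar_zero (ρ β κ : ℝ) : prabhakar ρ β κ 0 = (Real.Gamma β)⁻¹ := by
  rw [prabhakar, tsum_eq_single 0 fun m hm => by simp [hm]]
  simp

/-! ### The Caputo--Prabhakar kernel -/

/-- The kernel `t^{-α} E_{ρ,1-α}^{-γ}(ω t^ρ)`. -/
def cpKernel (ρ α ω γ t : ℝ) : ℝ := t ^ (-α) * prabhakar ρ (1 - α) (-γ) (ω * t ^ ρ)

/-- The primitive `t^{1-α} E_{ρ,2-α}^{-γ}(ω t^ρ)` of `cpKernel`. -/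
def cpKernelPrim (ρ α ω γ t : ℝ) : ℝ := t ^ (1 - α) * prabhakar ρ (2 - α) (-γ) (ω * t ^ ρ)

/-- The factor `-α E(ω t^ρ) + ρ ω t^ρ E'(ω t^ρ)` of `t^{-α-1}` in the derivative of `cpKernel`. -/
def cpKernelDerivFactor (ρ α ω γ t : ℝ) : ℝ :=
  -α * prabhakar ρ (1 - α) (-γ) (ω * t ^ ρ)
    + ρ * (ω * t ^ ρ * deriv (prabhakar ρ (1 - α) (-γ)) (ω * t ^ ρ))

section Kernel

variable {ρ α : ℝ} (ω γ : ℝ) (hρ : 0 < ρ) (hα : 0 < α ∧ α < 1)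
include hρ hα

lemma continuous_cpKernelPrim : Continuous (cpKernelPrim ρ α ω γ) := by
  have h1 := (differentiable_prabhakar (ρ := ρ) (β := 2 - α) (-γ) hρ (by linarith)).continuous
  exact (Real.continuous_rpow_const (by linarith)).mul
    (h1.comp (continuous_const.mul (Real.continuous_rpow_const hρ.le)))

lemma hasDerivAt_cpKernelPrim {t : ℝ} (ht : 0 < t) :
    HasDerivAt (cpKernelPrim ρ α ω γ) (cpKernel ρ α ω γ t) t := by
  have h1 := (differentiable_prabhakar (ρ := ρ) (β := 2 - α) (-γ) hρ (by linarith)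
    (ω * t ^ ρ)).hasDerivAt
  have h2 : HasDerivAt (fun s : ℝ => ω * s ^ ρ) (ω * (ρ * t ^ (ρ - 1))) t :=
    (Real.hasDerivAt_rpow_const (Or.inl ht.ne')).const_mul ω
  have h3 : HasDerivAt (fun s : ℝ => s ^ (1 - α)) ((1 - α) * t ^ (1 - α - 1)) t :=
    Real.hasDerivAt_rpow_const (Or.inl ht.ne')
  have h4 := h3.mul (h1.comp t h2)
  refine h4.congr_deriv ?_
  have h5 := prabhakar_eq_add_mul_deriv (-γ) hρ (β := 1 - α) (by linarith) (ω * t ^ ρ)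
  rw [show 1 - α + 1 = 2 - α by ring] at h5
  rw [cpKernel, h5, show 1 - α - 1 = -α by ring]
  have e1 : t ^ (1 - α) = t * t ^ (-α) := by
    rw [sub_eq_add_neg, Real.rpow_add ht, Real.rpow_one]
  have e2 : t ^ ρ = t * t ^ (ρ - 1) := by
    rw [Real.rpow_sub_one ht.ne']; field_simp
  simp only [Function.comp]
  rw [e1, show ∀ D : ℝ, t * t ^ (-α) * (D * (ω * (ρ * t ^ (ρ - 1))))
    = t ^ (-α) * (ρ * (ω * (t * t ^ (ρ - 1)) * D)) by intro D; ring, ← e2]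
  ring

lemma hasDerivAt_cpKernel {t : ℝ} (ht : 0 < t) :
    HasDerivAt (cpKernel ρ α ω γ) (t ^ (-α - 1) * cpKernelDerivFactor ρ α ω γ t) t := by
  have h1 := (differentiable_prabhakar (ρ := ρ) (β := 1 - α) (-γ) hρ (by linarith)
    (ω * t ^ ρ)).hasDerivAt
  have h2 : HasDerivAt (fun s : ℝ => ω * s ^ ρ) (ω * (ρ * t ^ (ρ - 1))) t :=
    (Real.hasDerivAt_rpow_const (Or.inl ht.ne')).const_mul ω
  have h3 : HasDerivAt (fun s : ℝ => s ^ (-α)) ((-α) * t ^ (-α - 1)) t :=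
    Real.hasDerivAt_rpow_const (Or.inl ht.ne')
  have h4 := h3.mul (h1.comp t h2)
  refine h4.congr_deriv ?_
  have e1 : t ^ (-α) = t * t ^ (-α - 1) := by
    rw [Real.rpow_sub_one ht.ne']; field_simp
  have e2 : t ^ ρ = t * t ^ (ρ - 1) := by
    rw [Real.rpow_sub_one ht.ne']; field_simp
  simp only [Function.comp]
  rw [e1, show ∀ D : ℝ, t * t ^ (-α - 1) * (D * (ω * (ρ * t ^ (ρ - 1))))
    = t ^ (-α - 1) * (ρ * (ω * (t * t ^ (ρ - 1)) * D)) by intro D; ring, ← e2,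
    cpKernelDerivFactor]
  ring

lemma continuous_cpKernelDerivFactor : Continuous (cpKernelDerivFactor ρ α ω γ) := by
  have h0 : Continuous fun t : ℝ => ω * t ^ ρ :=
    continuous_const.mul (Real.continuous_rpow_const hρ.le)
  have h1 := (differentiable_prabhakar (ρ := ρ) (β := 1 - α) (-γ) hρ (by linarith)).continuous
  have h2 := continuous_deriv_prabhakar (ρ := ρ) (β := 1 - α) (-γ) hρ (by linarith)
  exact (continuous_const.mul (h1.comp h0)).add
    (continuous_const.mul (h0.mul (h2.comp h0)))

/-- The factors multiplying `t^{-α}` and `t^{-α-1}` are continuous up to `t = 0` because `ρ > 0`.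
The whole singularity sits in the powers. -/
lemma exists_cpKernel_bound (T : ℝ) : ∃ C, 0 < C ∧ ∀ t ∈ Ioc 0 T,
    |cpKernel ρ α ω γ t| ≤ C * t ^ (-α) ∧
    |t ^ (-α - 1) * cpKernelDerivFactor ρ α ω γ t| ≤ C * t ^ (-α - 1) := by
  have h0 : Continuous fun t : ℝ => ω * t ^ ρ :=
    continuous_const.mul (Real.continuous_rpow_const hρ.le)
  have h1 := (differentiable_prabhakar (ρ := ρ) (β := 1 - α) (-γ) hρ (by linarith)).continuous
  obtain ⟨C₁, hC₁⟩ := isCompact_Icc.exists_bound_of_continuousOn (s := Icc 0 T)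
    (h1.comp h0).continuousOn
  obtain ⟨C₂, hC₂⟩ := isCompact_Icc.exists_bound_of_continuousOn (s := Icc 0 T)
    (continuous_cpKernelDerivFactor ω γ hρ hα).continuousOn
  refine ⟨max (max C₁ C₂) 1, by positivity, fun t ht => ?_⟩
  have ht' : t ∈ Icc 0 T := Ioc_subset_Icc_self ht
  have ht0 : 0 < t := ht.1
  constructor
  · rw [cpKernel, abs_mul, abs_of_pos (by positivity), mul_comm]
    refine mul_le_mul_of_nonneg_right ?_ (by positivity)
    exact (hC₁ t ht').trans ((le_max_left _ _).trans (le_max_left _ _))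
  · rw [abs_mul, abs_of_pos (by positivity), mul_comm]
    refine mul_le_mul_of_nonneg_right ?_ (by positivity)
    exact (hC₂ t ht').trans ((le_max_right _ _).trans (le_max_left _ _))

/-- Near zero the kernel is arbitrarily large and decreasing. -/
lemma exists_cpKernel_large (H : ℝ) {T : ℝ} (hT : 0 < T) : ∃ t₀, 0 < t₀ ∧ t₀ ≤ T ∧
    ∀ t ∈ Ioc 0 t₀, H ≤ cpKernel ρ α ω γ t ∧
      t ^ (-α - 1) * cpKernelDerivFactor ρ α ω γ t ≤ 0 := by
  have h0 : Continuous fun t : ℝ => ω * t ^ ρ :=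
    continuous_const.mul (Real.continuous_rpow_const hρ.le)
  have h1 := (differentiable_prabhakar (ρ := ρ) (β := 1 - α) (-γ) hρ (by linarith)).continuous
  have hG : 0 < (Real.Gamma (1 - α))⁻¹ :=
    inv_pos.2 (Real.Gamma_pos_of_pos (by linarith))
  have hP0 : prabhakar ρ (1 - α) (-γ) (ω * 0 ^ ρ) = (Real.Gamma (1 - α))⁻¹ := by
    rw [Real.zero_rpow hρ.ne', mul_zero, prabhakar_zero]
  have hev1 : ∀ᶠ t in 𝓝[>] (0 : ℝ),
      (Real.Gamma (1 - α))⁻¹ / 2 < prabhakar ρ (1 - α) (-γ) (ω * t ^ ρ) := by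
    have := (h1.comp h0).tendsto 0
    simp only [Function.comp, hP0] at this
    exact (this.mono_left nhdsWithin_le_nhds).eventually (lt_mem_nhds (by linarith))
  -- At `t = 0` the factor equals `-α/Γ(1-α) < 0`, whatever `ω` and `γ` are.
  have hev2 : ∀ᶠ t in 𝓝[>] (0 : ℝ), cpKernelDerivFactor ρ α ω γ t < 0 := by
    have := (continuous_cpKernelDerivFactor ω γ hρ hα).tendsto 0
    refine (this.mono_left nhdsWithin_le_nhds).eventually (gt_mem_nhds ?_)
    rw [cpKernelDerivFactor, hP0, Real.zero_rpow hρ.ne']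
    simp only [mul_zero, zero_mul, add_zero]
    nlinarith [hα.1]
  have hev3 : ∀ᶠ t in 𝓝[>] (0 : ℝ), |H| / ((Real.Gamma (1 - α))⁻¹ / 2) ≤ t ^ (-α) :=
    (tendsto_rpow_neg_nhdsGT_zero (by linarith [hα.1])).eventually_ge_atTop _
  obtain ⟨t₁, ht₁, h⟩ := (mem_nhdsGT_iff_exists_Ioc_subset).1
    (hev1.and (hev2.and hev3))
  refine ⟨min t₁ T, lt_min ht₁ hT, min_le_right _ _, fun t ht => ?_⟩
  obtain ⟨a1, a2, a3⟩ := h ⟨ht.1, ht.2.trans (min_le_left _ _)⟩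
  have ht0 : 0 < t := ht.1
  constructor
  · rw [div_le_iff₀ (by positivity)] at a3
    calc H ≤ |H| := le_abs_self H
      _ ≤ t ^ (-α) * ((Real.Gamma (1 - α))⁻¹ / 2) := a3
      _ ≤ cpKernel ρ α ω γ t := mul_le_mul_of_nonneg_left a1.le (by positivity)
  · exact mul_nonpos_of_nonneg_of_nonpos (by positivity) a2.le

end Kernel

/-- The scaling `μ = τ^α` turns the weight into a difference quotient of the primitive, that is, the
mean of the kernel over one time cell. -/
lemma coeff_eq {τ : ℝ} (ρ α ω γ : ℝ) (hτ : 0 < τ) {n : ℕ} (hn : 1 ≤ n) :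
    coeff ρ α ω γ τ n / τ ^ α
      = (cpKernelPrim ρ α ω γ (n * τ) - cpKernelPrim ρ α ω γ ((n - 1) * τ)) / τ := by
  have hn' : (1 : ℝ) ≤ n := by exact_mod_cast hn
  have e : τ ^ (1 - α) = τ / τ ^ α := by rw [Real.rpow_sub hτ, Real.rpow_one]
  rw [coeff, cpKernelPrim, cpKernelPrim, Real.mul_rpow (by positivity) hτ.le (z := 1 - α),
    Real.mul_rpow (by linarith) hτ.le (z := 1 - α), e]
  have : 0 < τ ^ α := by positivity
  field_simp

/-! ### Discrete energy estimates -/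

lemma sum_Icc_one_eq_sum_range (F : ℕ → ℝ) (m : ℕ) :
    ∑ i ∈ Finset.Icc 1 m, F i = ∑ i ∈ Finset.range m, F (i + 1) := by
  induction m with
  | zero => simp
  | succ m ih => rw [Finset.sum_Icc_succ_top (by omega), ih, Finset.sum_range_succ]

lemma sum_sub_reflect (c : ℕ → ℝ) (k : ℕ) :
    ∑ j ∈ Finset.Icc 1 (k - 1), c (k - j) = ∑ n ∈ Finset.Icc 1 (k - 1), c n := by
  refine Finset.sum_nbij' (fun j => k - j) (fun n => k - n) ?_ ?_ ?_ ?_ ?_ <;>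
    intro j hj <;> simp only [Finset.mem_Icc] at * <;> omega

lemma sum_sub_shift (c : ℕ → ℝ) (j N : ℕ) :
    ∑ k ∈ Finset.Icc (j + 1) N, c (k - j) = ∑ n ∈ Finset.Icc 1 (N - j), c n := by
  refine Finset.sum_nbij' (fun k => k - j) (fun n => n + j) ?_ ?_ ?_ ?_ ?_ <;>
    intro j hj <;> simp only [Finset.mem_Icc] at * <;> omega

/-- A discrete Young inequality: in each half of the sum, `x` at a given index is multiplied by a
partial sum of `c`. -/
lemma sum_convolution_le {c x : ℕ → ℝ} (hc : ∀ n, 0 ≤ c n) (hx : ∀ n, 0 ≤ x n) (N : ℕ) :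
    ∑ k ∈ Finset.Icc 1 N, ∑ j ∈ Finset.Icc 1 (k - 1), c (k - j) * ((x j + x k) / 2)
      ≤ (∑ n ∈ Finset.Icc 1 (N - 1), c n) * ∑ k ∈ Finset.Icc 1 N, x k := by
  set β := ∑ n ∈ Finset.Icc 1 (N - 1), c n
  have h1 : ∑ k ∈ Finset.Icc 1 N, ∑ j ∈ Finset.Icc 1 (k - 1), c (k - j) * x k
      ≤ β * ∑ k ∈ Finset.Icc 1 N, x k := by
    rw [Finset.mul_sum]
    refine Finset.sum_le_sum fun k hk => ?_
    rw [← Finset.sum_mul, sum_sub_reflect]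
    refine mul_le_mul_of_nonneg_right ?_ (hx k)
    refine Finset.sum_le_sum_of_subset_of_nonneg (Finset.Icc_subset_Icc le_rfl ?_)
      fun _ _ _ => hc _
    have := (Finset.mem_Icc.1 hk).2
    omega
  have h2 : ∑ k ∈ Finset.Icc 1 N, ∑ j ∈ Finset.Icc 1 (k - 1), c (k - j) * x j
      ≤ β * ∑ k ∈ Finset.Icc 1 N, x k := by
    rw [Finset.sum_comm' (t' := Finset.Icc 1 N) (s' := fun j => Finset.Icc (j + 1) N)
      (by intro a b; simp only [Finset.mem_Icc]; omega), Finset.mul_sum]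
    refine Finset.sum_le_sum fun j hj => ?_
    rw [← Finset.sum_mul, sum_sub_shift]
    refine mul_le_mul_of_nonneg_right ?_ (hx j)
    refine Finset.sum_le_sum_of_subset_of_nonneg (Finset.Icc_subset_Icc le_rfl ?_)
      fun _ _ _ => hc _
    have := (Finset.mem_Icc.1 hj).1
    omega
  have h3 : ∑ k ∈ Finset.Icc 1 N, ∑ j ∈ Finset.Icc 1 (k - 1), c (k - j) * ((x j + x k) / 2)
      = (∑ k ∈ Finset.Icc 1 N, ∑ j ∈ Finset.Icc 1 (k - 1), c (k - j) * x j
        + ∑ k ∈ Finset.Icc 1 N, ∑ j ∈ Finset.Icc 1 (k - 1), c (k - j) * x k) / 2 := by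
    rw [← Finset.sum_add_distrib, Finset.sum_div]
    refine Finset.sum_congr rfl fun k _ => ?_
    rw [← Finset.sum_add_distrib, Finset.sum_div]
    exact Finset.sum_congr rfl fun j _ => by ring
  rw [h3]
  linarith

/-- Coercivity of a discrete Volterra operator with respect to a geometrically weighted inner
product. -/
lemma weighted_coercivity (b₀ : ℝ) (b y : ℕ → ℝ) {q : ℝ} (hq : 0 < q) (N : ℕ) :
    (b₀ - ∑ n ∈ Finset.Icc 1 (N - 1), |b n| * q ^ n) *
        ∑ k ∈ Finset.Icc 1 N, q ^ (2 * k) * y k ^ 2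
      ≤ ∑ k ∈ Finset.Icc 1 N, q ^ (2 * k) *
        (y k * (b₀ * y k - ∑ j ∈ Finset.Icc 1 (k - 1), b (k - j) * y j)) := by
  have h1 := sum_convolution_le (c := fun n => |b n| * q ^ n)
    (x := fun k => q ^ (2 * k) * y k ^ 2) (fun n => by positivity) (fun n => by positivity) N
  have h2 : ∑ k ∈ Finset.Icc 1 N, q ^ (2 * k) *
        (y k * ∑ j ∈ Finset.Icc 1 (k - 1), b (k - j) * y j)
      ≤ ∑ k ∈ Finset.Icc 1 N, ∑ j ∈ Finset.Icc 1 (k - 1),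
        |b (k - j)| * q ^ (k - j) * ((q ^ (2 * j) * y j ^ 2 + q ^ (2 * k) * y k ^ 2) / 2) := by
    refine Finset.sum_le_sum fun k _ => ?_
    rw [Finset.mul_sum, Finset.mul_sum]
    refine Finset.sum_le_sum fun j hj => ?_
    obtain ⟨n, rfl⟩ : ∃ n, k = j + n := ⟨k - j, by have := (Finset.mem_Icc.1 hj).2; omega⟩
    rw [Nat.add_sub_cancel_left]
    -- With `k = j + n`, split `q^{2k} = q^n q^j q^k`: `q^n` damps the kernel and the other two
    -- powers go to `y j` and `y k`, ready for the arithmetic-geometric mean inequality.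
    have e1 : q ^ (2 * (j + n)) * (y (j + n) * (b n * y j))
        = q ^ n * (b n * ((q ^ j * y j) * (q ^ (j + n) * y (j + n)))) := by ring
    have e2 : |b n| * q ^ n * ((q ^ (2 * j) * y j ^ 2 + q ^ (2 * (j + n)) * y (j + n) ^ 2) / 2)
        = q ^ n * (|b n| * (((q ^ j * y j) ^ 2 + (q ^ (j + n) * y (j + n)) ^ 2) / 2)) := by ring
    rw [e1, e2]
    refine mul_le_mul_of_nonneg_left ?_ (by positivity)
    generalize q ^ j * y j = s
    generalize q ^ (j + n) * y (j + n) = t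
    calc b n * (s * t) ≤ |b n| * |s * t| := by rw [← abs_mul]; exact le_abs_self _
      _ ≤ |b n| * ((s ^ 2 + t ^ 2) / 2) := by
        refine mul_le_mul_of_nonneg_left ?_ (abs_nonneg _)
        rw [abs_le]
        constructor <;> nlinarith [sq_nonneg (s + t), sq_nonneg (s - t)]
  have h3 : ∑ k ∈ Finset.Icc 1 N, q ^ (2 * k) *
        (y k * (b₀ * y k - ∑ j ∈ Finset.Icc 1 (k - 1), b (k - j) * y j))
      = b₀ * ∑ k ∈ Finset.Icc 1 N, q ^ (2 * k) * y k ^ 2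
        - ∑ k ∈ Finset.Icc 1 N, q ^ (2 * k) *
          (y k * ∑ j ∈ Finset.Icc 1 (k - 1), b (k - j) * y j) := by
    rw [Finset.mul_sum, ← Finset.sum_sub_distrib]
    exact Finset.sum_congr rfl fun k _ => by ring
  rw [h3, sub_mul]
  linarith

/-! ### Summation by parts in space and the convective term. -/

lemma sum_mul_secondDiff {h : ℝ} (hh : 0 < h) {M : ℕ} (hM : 1 ≤ M) {w : ℕ → ℝ}
    (h0 : w 0 = 0) (h1 : w M = 0) :
    ∑ i ∈ Finset.Icc 1 (M - 1), h * (w i * secondDiff h w i)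
      = -gridNormSq h M (backwardDiff h w) := by
  obtain ⟨m, rfl⟩ : ∃ m, M = m + 1 := ⟨M - 1, by omega⟩
  -- Summation by parts with its boundary terms kept, so that the induction does not need `w` to
  -- vanish at the right end.
  have key : ∀ m : ℕ, ∑ i ∈ Finset.range m, w (i + 1) * (w (i + 2) - 2 * w (i + 1) + w i)
      + ∑ i ∈ Finset.range (m + 1), (w (i + 1) - w i) ^ 2
      = w (m + 1) * (w (m + 1) - w m) - w 0 * (w 1 - w 0) := by
    intro m
    induction m with
    | zero => simp; ring
    | succ m ih =>
      rw [Finset.sum_range_succ, Finset.sum_range_succ _ (m + 1)]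
      linear_combination ih
  have k1 := key m
  rw [h0, h1] at k1
  rw [gridNormSq, sum_Icc_one_eq_sum_range, sum_Icc_one_eq_sum_range, Nat.add_sub_cancel]
  simp only [secondDiff, backwardDiff, Nat.add_sub_cancel]
  have e1 : ∑ i ∈ Finset.range m,
      h * (w (i + 1) * ((w (i + 1 + 1) - 2 * w (i + 1) + w i) / h ^ 2))
      = 1 / h * ∑ i ∈ Finset.range m, w (i + 1) * (w (i + 2) - 2 * w (i + 1) + w i) := by
    rw [Finset.mul_sum]
    exact Finset.sum_congr rfl fun i _ => by field_simp
  have e2 : ∑ i ∈ Finset.range (m + 1), h * ((w (i + 1) - w i) / h) ^ 2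
      = 1 / h * ∑ i ∈ Finset.range (m + 1), (w (i + 1) - w i) ^ 2 := by
    rw [Finset.mul_sum]
    exact Finset.sum_congr rfl fun i _ => by field_simp
  rw [e1, e2]
  linear_combination (1 / h) * k1

/-- The discretisation `w Δw + Δ(w²)` of `6 h w w_x`. -/
def convection (w : ℕ → ℝ) (i : ℕ) : ℝ :=
  w i * centralDiff w i + centralDiff (fun l => w l ^ 2) i

/-- With `u = a - e`, all cubic terms in `e` go into a telescoping flux that vanishes with `e` at
both ends. What remains is quadratic in `e` with differences of `a` as coefficients, so only `a` has
to be Lipschitz. -/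
lemma convection_energy {h C : ℝ} {M : ℕ} (hM : 1 ≤ M) {a u : ℕ → ℝ}
    (h0 : a 0 = u 0) (h1 : a M = u M) (ha : ∀ i < M, |a (i + 1) - a i| ≤ h * C) :
    -(3 * (h * C) * ∑ i ∈ Finset.Icc 1 (M - 1), (a i - u i) ^ 2)
      ≤ ∑ i ∈ Finset.Icc 1 (M - 1), (a i - u i) * (convection a i - convection u i) := by
  obtain ⟨m, rfl⟩ : ∃ m, M = m + 1 := ⟨M - 1, by omega⟩
  obtain ⟨e, he⟩ : ∃ e : ℕ → ℝ, ∀ i, e i = a i - u i := ⟨_, fun _ => rfl⟩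
  have e0 : e 0 = 0 := by rw [he, h0, sub_self]
  have e1 : e (m + 1) = 0 := by rw [he, h1, sub_self]
  have hu : ∀ i, u i = a i - e i := fun i => by rw [he]; ring
  rw [Nat.add_sub_cancel, sum_Icc_one_eq_sum_range, sum_Icc_one_eq_sum_range]
  simp only [← he]
  have key : ∀ m : ℕ, ∑ i ∈ Finset.range m, e (i + 1) * (convection a (i + 1) - convection u (i + 1))
      = ∑ i ∈ Finset.range m, (e (i + 1) ^ 2 * (a (i + 2) - a i)
          + (a (i + 2) - a (i + 1)) * (e (i + 1) * e (i + 2)))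
        + (e m * e (m + 1) * (2 * a m + a (m + 1) - e m - e (m + 1))
          - e 0 * e 1 * (2 * a 0 + a 1 - e 0 - e 1)) := by
    intro m
    induction m with
    | zero => simp
    | succ m ih =>
      rw [Finset.sum_range_succ, ih, Finset.sum_range_succ]
      simp only [convection, centralDiff, hu, Nat.add_sub_cancel, add_assoc, Nat.reduceAdd]
      ring
  -- Shifting the index loses `e_1²` and gains `e_{m+1}² = 0`.
  have hshift : ∑ i ∈ Finset.range m, e (i + 2) ^ 2 ≤ ∑ i ∈ Finset.range m, e (i + 1) ^ 2 := by
    have := Finset.sum_range_succ (fun i => e (i + 1) ^ 2) m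
    rw [Finset.sum_range_succ'] at this
    simp only [e1] at this
    nlinarith [sq_nonneg (e (0 + 1))]
  rw [key, e0, e1]
  -- The two-step difference of `a` costs `2hC e_{i+1}²` and the mixed product `hC (e_{i+1}² +
  -- e_{i+2}²)/2`. After the shift the total constant is `5/2 + 1/2 = 3`.
  have hpt : ∀ i ∈ Finset.range m,
      -(h * C * (5 / 2 * e (i + 1) ^ 2 + 1 / 2 * e (i + 2) ^ 2))
      ≤ e (i + 1) ^ 2 * (a (i + 2) - a i) + (a (i + 2) - a (i + 1)) * (e (i + 1) * e (i + 2)) := by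
    intro i hi
    have hi' := Finset.mem_range.1 hi
    obtain ⟨p1, p2⟩ := abs_le.1 (ha i (by omega))
    obtain ⟨p3, p4⟩ := abs_le.1 (ha (i + 1) (by omega))
    rw [show i + 1 + 1 = i + 2 from rfl] at p3 p4
    have s1 : -(2 * (h * C)) * e (i + 1) ^ 2 ≤ e (i + 1) ^ 2 * (a (i + 2) - a i) := by
      nlinarith [sq_nonneg (e (i + 1))]
    nlinarith [mul_nonneg (sub_nonneg.2 p4) (sq_nonneg (e (i + 1) - e (i + 2))),
      mul_nonneg (by linarith : 0 ≤ a (i + 2) - a (i + 1) + h * C)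
        (sq_nonneg (e (i + 1) + e (i + 2)))]
  have hsum := Finset.sum_le_sum hpt
  have hhC : 0 ≤ h * C := (abs_nonneg _).trans (ha 0 (by omega))
  rw [Finset.sum_neg_distrib, ← Finset.mul_sum, Finset.sum_add_distrib, ← Finset.mul_sum,
    ← Finset.mul_sum] at hsum
  nlinarith

/-- The energy inequality for the difference of a grid function `a` and a solution `u` of one step
of the scheme. -/
lemma step_energy {h C R : ℝ} (hh : 0 < h) {M : ℕ} (hM : 1 ≤ M) {a u d r : ℕ → ℝ}
    (a0 : a 0 = u 0) (a1 : a M = u M) (ha : ∀ i < M, |a (i + 1) - a i| ≤ h * C)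
    (hr : ∀ i ∈ Finset.Icc 1 (M - 1), |r i| ≤ R)
    (heq : ∀ i ∈ Finset.Icc 1 (M - 1), d i + 1 / (6 * h) * (convection a i - convection u i)
      = secondDiff h (fun l => a l - u l) i + r i) :
    ∑ i ∈ Finset.Icc 1 (M - 1), h * ((a i - u i) * d i)
        + gridNormSq h M (backwardDiff h fun l => a l - u l)
      ≤ C / 2 * ∑ i ∈ Finset.Icc 1 (M - 1), h * (a i - u i) ^ 2
        + ∑ i ∈ Finset.Icc 1 (M - 1), h * (R * |a i - u i|) := by
  have h1 := sum_mul_secondDiff hh hM (w := fun l => a l - u l)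
    (by simp only [a0, sub_self]) (by simp only [a1, sub_self])
  have h2 := convection_energy hM a0 a1 ha
  -- The grid weight `h` cancels the `1/h` of the convection, leaving `1/6`. Hence `3hC` becomes the
  -- `C/2` of the conclusion.
  have h3 : ∑ i ∈ Finset.Icc 1 (M - 1), h * ((a i - u i) * d i)
      + 1 / 6 * ∑ i ∈ Finset.Icc 1 (M - 1), (a i - u i) * (convection a i - convection u i)
      = ∑ i ∈ Finset.Icc 1 (M - 1), h * ((a i - u i) * secondDiff h (fun l => a l - u l) i)
      + ∑ i ∈ Finset.Icc 1 (M - 1), h * ((a i - u i) * r i) := by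
    rw [Finset.mul_sum, ← Finset.sum_add_distrib, ← Finset.sum_add_distrib]
    refine Finset.sum_congr rfl fun i hi => ?_
    have := heq i hi
    field_simp at this ⊢
    linear_combination (a i - u i) * this
  have h4 : ∑ i ∈ Finset.Icc 1 (M - 1), h * ((a i - u i) * r i)
      ≤ ∑ i ∈ Finset.Icc 1 (M - 1), h * (R * |a i - u i|) := by
    refine Finset.sum_le_sum fun i hi => mul_le_mul_of_nonneg_left ?_ hh.le
    calc (a i - u i) * r i ≤ |r i| * |a i - u i| := by
          rw [mul_comm, ← abs_mul]; exact le_abs_self _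
      _ ≤ _ := mul_le_mul_of_nonneg_right (hr i hi) (abs_nonneg _)
  have h5 : ∑ i ∈ Finset.Icc 1 (M - 1), h * (a i - u i) ^ 2
      = h * ∑ i ∈ Finset.Icc 1 (M - 1), (a i - u i) ^ 2 := by rw [Finset.mul_sum]
  rw [h5]
  linarith

/-- Summation in time of the energy inequalities. -/
lemma sum_energy_le {h c η R q b₀ : ℝ} {b : ℕ → ℝ} (hh : 0 < h) (hη : 0 < η) (hq : 0 < q)
    (hq1 : q ≤ 1) {M N : ℕ} {y : ℕ → ℕ → ℝ}
    (hb : c + η ≤ b₀ - ∑ n ∈ Finset.Icc 1 (N - 1), |b n| * q ^ n)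
    (hE : ∀ k ∈ Finset.Icc 1 N,
      ∑ i ∈ Finset.Icc 1 (M - 1),
          h * (y k i * (b₀ * y k i - ∑ j ∈ Finset.Icc 1 (k - 1), b (k - j) * y j i))
        + gridNormSq h M (backwardDiff h (y k))
      ≤ c * ∑ i ∈ Finset.Icc 1 (M - 1), h * y k i ^ 2
        + ∑ i ∈ Finset.Icc 1 (M - 1), h * (R * |y k i|)) :
    q ^ (2 * N) * ∑ k ∈ Finset.Icc 1 N, gridNormSq h M (backwardDiff h (y k))
      ≤ N * (M * h * (R ^ 2 / (4 * η))) := by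
  have hG : ∀ k, 0 ≤ gridNormSq h M (backwardDiff h (y k)) := fun k =>
    Finset.sum_nonneg fun i _ => by positivity
  -- Coercivity in time is applied at each space node separately and then summed over the nodes.
  have hco : (c + η) * ∑ k ∈ Finset.Icc 1 N, q ^ (2 * k) *
        ∑ i ∈ Finset.Icc 1 (M - 1), h * y k i ^ 2
      ≤ ∑ k ∈ Finset.Icc 1 N, q ^ (2 * k) * ∑ i ∈ Finset.Icc 1 (M - 1),
          h * (y k i * (b₀ * y k i - ∑ j ∈ Finset.Icc 1 (k - 1), b (k - j) * y j i)) := by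
    simp only [Finset.mul_sum (Finset.Icc 1 (M - 1))]
    rw [Finset.sum_comm, Finset.sum_comm (s := Finset.Icc 1 N) (t := Finset.Icc 1 (M - 1)),
      Finset.mul_sum]
    refine Finset.sum_le_sum fun i _ => ?_
    have h1 := weighted_coercivity b₀ b (fun k => y k i) hq N
    have h2 : 0 ≤ ∑ k ∈ Finset.Icc 1 N, q ^ (2 * k) * y k i ^ 2 :=
      Finset.sum_nonneg fun k _ => by positivity
    calc (c + η) * ∑ k ∈ Finset.Icc 1 N, q ^ (2 * k) * (h * y k i ^ 2)
        = h * ((c + η) * ∑ k ∈ Finset.Icc 1 N, q ^ (2 * k) * y k i ^ 2) := by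
          simp only [Finset.mul_sum]
          exact Finset.sum_congr rfl fun k _ => by ring
      _ ≤ h * ∑ k ∈ Finset.Icc 1 N, q ^ (2 * k) *
          (y k i * (b₀ * y k i - ∑ j ∈ Finset.Icc 1 (k - 1), b (k - j) * y j i)) :=
        mul_le_mul_of_nonneg_left ((mul_le_mul_of_nonneg_right hb h2).trans h1) hh.le
      _ = _ := by
          rw [Finset.mul_sum]
          exact Finset.sum_congr rfl fun k _ => by ring
  -- Young's inequality; the surplus `η` in `hb` is there to absorb `η y²`.
  have hR : ∀ k, ∑ i ∈ Finset.Icc 1 (M - 1), h * (R * |y k i|)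
      ≤ η * ∑ i ∈ Finset.Icc 1 (M - 1), h * y k i ^ 2 + M * h * (R ^ 2 / (4 * η)) := by
    intro k
    have hcard : ∑ i ∈ Finset.Icc 1 (M - 1), h * (R ^ 2 / (4 * η))
        ≤ M * h * (R ^ 2 / (4 * η)) := by
      rw [Finset.sum_const, nsmul_eq_mul, Nat.card_Icc, ← mul_assoc]
      have : ((M - 1 + 1 - 1 : ℕ) : ℝ) ≤ M := by exact_mod_cast (by omega)
      gcongr
    refine le_trans ?_ (add_le_add_right hcard _)
    rw [Finset.mul_sum, ← Finset.sum_add_distrib]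
    refine Finset.sum_le_sum fun i _ => ?_
    have : R * |y k i| ≤ η * y k i ^ 2 + R ^ 2 / (4 * η) := by
      rw [← sq_abs (y k i), ← sub_le_iff_le_add', le_div_iff₀ (by positivity)]
      nlinarith [sq_nonneg (2 * η * |y k i| - R)]
    nlinarith [mul_le_mul_of_nonneg_left this hh.le]
  have hsum : ∑ k ∈ Finset.Icc 1 N, q ^ (2 * k) * (∑ i ∈ Finset.Icc 1 (M - 1),
          h * (y k i * (b₀ * y k i - ∑ j ∈ Finset.Icc 1 (k - 1), b (k - j) * y j i))
        + gridNormSq h M (backwardDiff h (y k)))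
      ≤ ∑ k ∈ Finset.Icc 1 N, ((c + η) * (q ^ (2 * k) *
          ∑ i ∈ Finset.Icc 1 (M - 1), h * y k i ^ 2) + M * h * (R ^ 2 / (4 * η))) := by
    refine Finset.sum_le_sum fun k hk => ?_
    have hqk : q ^ (2 * k) ≤ 1 := pow_le_one₀ hq.le hq1
    have h1 := mul_le_mul_of_nonneg_left ((hE k hk).trans (add_le_add_right (hR k) _))
      (by positivity : 0 ≤ q ^ (2 * k))
    have h2 : q ^ (2 * k) * (M * h * (R ^ 2 / (4 * η))) ≤ M * h * (R ^ 2 / (4 * η)) :=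
      mul_le_of_le_one_left (by positivity) hqk
    linarith
  simp only [mul_add] at hsum
  rw [Finset.sum_add_distrib, Finset.sum_add_distrib, ← Finset.mul_sum, Finset.sum_const,
    nsmul_eq_mul, Nat.card_Icc, Nat.add_sub_cancel] at hsum
  -- The weights are bounded below by `q^{2N}` on the gradient term and above by `1` on the source.
  -- This factor is the only loss due to weighting.
  have hfin : q ^ (2 * N) * ∑ k ∈ Finset.Icc 1 N, gridNormSq h M (backwardDiff h (y k))
      ≤ ∑ k ∈ Finset.Icc 1 N, q ^ (2 * k) * gridNormSq h M (backwardDiff h (y k)) := by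
    rw [Finset.mul_sum]
    refine Finset.sum_le_sum fun k hk => mul_le_mul_of_nonneg_right ?_ (hG k)
    exact pow_le_pow_of_le_one hq.le hq1 (by have := (Finset.mem_Icc.1 hk).2; omega)
  linarith

/-! ### The weights of the discrete derivative -/

/-- The weight `a_n / μ`. -/
def cpWeight (ρ α ω γ τ : ℝ) (n : ℕ) : ℝ := coeff ρ α ω γ τ n / τ ^ α

lemma discreteCP_eq (ρ α ω γ τ : ℝ) (y : ℕ → ℝ) (k : ℕ) :
    discreteCP ρ α ω γ τ y k = cpWeight ρ α ω γ τ 1 * y k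
      - ∑ j ∈ Finset.Icc 1 (k - 1),
        (cpWeight ρ α ω γ τ (k - j) - cpWeight ρ α ω γ τ (k - j + 1)) * y j
      - cpWeight ρ α ω γ τ k * y 0 := by
  simp only [discreteCP, cpWeight, mul_sub, Finset.mul_sum]
  congr 1
  · congr 1
    · ring
    · exact Finset.sum_congr rfl fun j _ => by ring
  · ring

/-- Abel summation. The energy argument uses the form with differences of weights; consistency needs
this one, with weights times increments of `y`, which is a quadrature of the convolution with `g'`.
-/
lemma discreteCP_eq_sum_diff (ρ α ω γ τ : ℝ) (y : ℕ → ℝ) {k : ℕ} (hk : 1 ≤ k) :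
    discreteCP ρ α ω γ τ y k
      = ∑ m ∈ Finset.range k, cpWeight ρ α ω γ τ (m + 1) * (y (k - m) - y (k - (m + 1))) := by
  obtain ⟨k, rfl⟩ : ∃ l, k = l + 1 := ⟨k - 1, by omega⟩
  rw [discreteCP_eq, Nat.add_sub_cancel]
  generalize cpWeight ρ α ω γ τ = A
  have h1 : ∑ j ∈ Finset.Icc 1 k, (A (k + 1 - j) - A (k + 1 - j + 1)) * y j
      = ∑ n ∈ Finset.range k, (A (n + 1) - A (n + 1 + 1)) * y (k - n) := by
    refine Finset.sum_nbij' (fun j => k - j) (fun n => k - n) ?_ ?_ ?_ ?_ ?_ <;>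
      intro j hj <;> simp only [Finset.mem_Icc, Finset.mem_range] at * <;> try omega
    rw [show k + 1 - j = k - j + 1 by omega, show k - (k - j) = j by omega]
  have key : ∀ m ≤ k, ∑ n ∈ Finset.range (m + 1), A (n + 1) * (y (k + 1 - n) - y (k + 1 - (n + 1)))
      = A 1 * y (k + 1) - ∑ n ∈ Finset.range m, (A (n + 1) - A (n + 1 + 1)) * y (k - n)
        - A (m + 1) * y (k - m) := by
    intro m hm
    induction m with
    | zero => simp; ring
    | succ m ih =>
      rw [Finset.sum_range_succ, ih (by omega), Finset.sum_range_succ _ m,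
        show k + 1 - (m + 1) = k - m by omega, show k + 1 - (m + 1 + 1) = k - (m + 1) by omega]
      ring
  rw [h1, key k le_rfl, Nat.sub_self]

section Weights

variable {ρ α : ℝ} (ω γ : ℝ) (hρ : 0 < ρ) (hα : 0 < α ∧ α < 1)
include hρ hα

/-- The weights are values of the kernel. -/
lemma exists_cpWeight_eq {τ : ℝ} (hτ : 0 < τ) {n : ℕ} (hn : 1 ≤ n) :
    ∃ ξ ∈ Ioo (((n : ℝ) - 1) * τ) (n * τ), cpWeight ρ α ω γ τ n = cpKernel ρ α ω γ ξ := by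
  have hn' : (1 : ℝ) ≤ n := by exact_mod_cast hn
  obtain ⟨ξ, hξ, h⟩ := exists_hasDerivAt_eq_slope (cpKernelPrim ρ α ω γ) (cpKernel ρ α ω γ)
    (show ((n : ℝ) - 1) * τ < n * τ by nlinarith)
    (continuous_cpKernelPrim ω γ hρ hα).continuousOn
    (fun x hx => hasDerivAt_cpKernelPrim ω γ hρ hα
      (lt_of_le_of_lt (mul_nonneg (by linarith) hτ.le) hx.1))
  refine ⟨ξ, hξ, ?_⟩
  rw [h, cpWeight, coeff_eq ρ α ω γ hτ hn]
  congr 1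
  ring

lemma cpKernel_antitoneOn {t₀ : ℝ}
    (h : ∀ t ∈ Ioc 0 t₀, t ^ (-α - 1) * cpKernelDerivFactor ρ α ω γ t ≤ 0) :
    AntitoneOn (cpKernel ρ α ω γ) (Ioc 0 t₀) := by
  refine antitoneOn_of_hasDerivWithinAt_nonpos (convex_Ioc 0 t₀)
    (f' := fun t => t ^ (-α - 1) * cpKernelDerivFactor ρ α ω γ t)
    (fun t ht => (hasDerivAt_cpKernel ω γ hρ hα ht.1).continuousAt.continuousWithinAt)
    (fun t ht => ?_) (fun t ht => h t (interior_subset ht))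
  exact (hasDerivAt_cpKernel ω γ hρ hα (interior_subset ht).1).hasDerivWithinAt

lemma abs_cpKernel_sub_le {T C a x y : ℝ} (ha : 0 < a)
    (hC : ∀ t ∈ Ioc 0 T, |t ^ (-α - 1) * cpKernelDerivFactor ρ α ω γ t| ≤ C * t ^ (-α - 1))
    (hC0 : 0 ≤ C) (hx : x ∈ Icc a T) (hy : y ∈ Icc a T) :
    |cpKernel ρ α ω γ x - cpKernel ρ α ω γ y| ≤ C * a ^ (-α - 1) * |x - y| := by
  have := (convex_Icc a T).norm_image_sub_le_of_norm_hasDerivWithin_le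
    (f := cpKernel ρ α ω γ) (f' := fun t => t ^ (-α - 1) * cpKernelDerivFactor ρ α ω γ t)
    (C := C * a ^ (-α - 1))
    (fun t ht => (hasDerivAt_cpKernel ω γ hρ hα (ha.trans_le ht.1)).hasDerivWithinAt)
    (fun t ht => (hC t ⟨ha.trans_le ht.1, ht.2⟩).trans
      (mul_le_mul_of_nonneg_left (Real.rpow_le_rpow_of_nonpos ha ht.1 (by linarith)) hC0)) hy hx
  simpa only [Real.norm_eq_abs] using this

/-- On fine meshes the weighted Volterra operator is coercive with any prescribed constant. -/
lemma exists_weight_of_fine (c : ℝ) {T : ℝ} (hT : 0 < T) : ∃ N₀ : ℕ, ∃ θ : ℝ, 0 < θ ∧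
    ∀ N : ℕ, N₀ ≤ N → 1 ≤ N → ∃ q : ℝ, 0 < q ∧ q ≤ 1 ∧ θ ≤ q ^ (2 * N) ∧
      c ≤ cpWeight ρ α ω γ (T / N) 1 - ∑ n ∈ Finset.Icc 1 (N - 1),
        |cpWeight ρ α ω γ (T / N) n - cpWeight ρ α ω γ (T / N) (n + 1)| * q ^ n := by
  obtain ⟨C, hC0, hC⟩ := exists_cpKernel_bound ω γ hρ hα T
  -- The extra unit above `c` pays for the tail of the sum.
  obtain ⟨t₀, ht₀, ht₀T, hlarge⟩ := exists_cpKernel_large ω γ hρ hα (c + 1) hT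
  have hanti := cpKernel_antitoneOn ω γ hρ hα fun t ht => (hlarge t ht).2
  set B := C * (t₀ / 2) ^ (-α - 1) with hB
  have hB0 : 0 < B := by positivity
  -- Chosen so that `l t₀/2 = 2BT`; then `x + 1 ≤ exp x` gives `2BT q^n ≤ 1` as soon as `nτ ≥ t₀/2`.
  set l := 2 * (2 * B * T) / t₀ with hl
  have hl0 : 0 < l := by positivity
  -- This forces `4τ ≤ t₀`, so every cell from the `m`-th on lies in `[t₀/2, T]`, although `mτ` may
  -- fall short of `t₀` by almost `τ`.
  obtain ⟨N₀, hN₀⟩ := exists_nat_gt (4 * T / t₀)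
  refine ⟨N₀, Real.exp (-(2 * l * T)), Real.exp_pos _, fun N hN hN1 => ?_⟩
  have hNpos : (0 : ℝ) < N := by exact_mod_cast hN1
  set τ := T / N with hτdef
  have hτ : 0 < τ := by positivity
  have hNτ : N * τ = T := by rw [hτdef]; field_simp
  have hτ4 : 4 * τ ≤ t₀ := by
    have h1 : 4 * T / t₀ ≤ N := hN₀.le.trans (by exact_mod_cast hN)
    rw [div_le_iff₀ ht₀] at h1
    rw [hτdef, ← mul_div_assoc, div_le_iff₀ hNpos]
    linarith
  set q := Real.exp (-(l * τ)) with hq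
  have hqn : ∀ n : ℕ, q ^ n = Real.exp (-(l * (n * τ))) := fun n => by
    rw [hq, ← Real.exp_nat_mul]; congr 1; ring
  have hq1 : q ≤ 1 := by rw [hq, Real.exp_le_one_iff]; nlinarith
  refine ⟨q, Real.exp_pos _, hq1, ?_, ?_⟩
  · rw [hqn]
    refine Real.exp_le_exp.2 ?_
    push_cast
    rw [mul_assoc 2 (N : ℝ) τ, hNτ]
    linarith
  set A := cpWeight ρ α ω γ τ with hA
  -- The number of whole cells in `(0, t₀]`, where the kernel is decreasing.
  set m := ⌊t₀ / τ⌋₊ with hm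
  have hmle : m * τ ≤ t₀ := by
    have := Nat.floor_le (show 0 ≤ t₀ / τ by positivity)
    rwa [le_div_iff₀ hτ] at this
  have hmlt : t₀ < (m + 1) * τ := by
    have := Nat.lt_floor_add_one (t₀ / τ)
    rwa [div_lt_iff₀ hτ] at this
  have hm1 : 1 ≤ m := by
    rw [hm, Nat.one_le_floor_iff, le_div_iff₀ hτ]
    linarith
  have hmN : m ≤ N := by
    have h : (m : ℝ) * τ ≤ N * τ := by linarith
    exact_mod_cast le_of_mul_le_mul_right h hτ
  have hpos : ∀ n : ℕ, 1 ≤ n → ∀ ξ ∈ Ioo (((n : ℝ) - 1) * τ) (n * τ), 0 < ξ := by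
    intro n hn ξ hξ
    have : (1 : ℝ) ≤ n := by exact_mod_cast hn
    exact lt_of_le_of_lt (mul_nonneg (by linarith) hτ.le) hξ.1
  have hdec : ∀ n : ℕ, 1 ≤ n → n < m → A (n + 1) ≤ A n := by
    intro n hn hnm
    obtain ⟨ξ, hξ, e1⟩ := exists_cpWeight_eq ω γ hρ hα hτ hn
    obtain ⟨ζ, hζ, e2⟩ := exists_cpWeight_eq ω γ hρ hα hτ (Nat.le_add_left 1 n)
    have h0 := hpos _ hn ξ hξ
    push_cast at hζ
    have hle : ((n : ℝ) + 1) * τ ≤ m * τ := by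
      have : ((n : ℝ) + 1) ≤ m := by exact_mod_cast hnm
      gcongr
    have hlt : ξ < ζ := by have := hξ.2; have := hζ.1; linarith
    rw [hA, e1, e2]
    exact hanti ⟨h0, by linarith [hζ.2]⟩ ⟨h0.trans hlt, by linarith [hζ.2]⟩ hlt.le
  have hAm : c + 1 ≤ A m := by
    obtain ⟨ξ, hξ, e1⟩ := exists_cpWeight_eq ω γ hρ hα hτ hm1
    rw [hA, e1]
    exact (hlarge ξ ⟨hpos _ hm1 ξ hξ, by linarith [hξ.2]⟩).1
  have htail : ∀ n : ℕ, m ≤ n → n < N → |A n - A (n + 1)| ≤ B * (2 * τ) := by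
    intro n hn hnN
    obtain ⟨ξ, hξ, e1⟩ := exists_cpWeight_eq ω γ hρ hα hτ (hm1.trans hn)
    obtain ⟨ζ, hζ, e2⟩ := exists_cpWeight_eq ω γ hρ hα hτ (Nat.le_add_left 1 n)
    push_cast at hζ
    have hnR : (m : ℝ) * τ ≤ n * τ := by
      have : (m : ℝ) ≤ n := by exact_mod_cast hn
      gcongr
    have hnN' : ((n : ℝ) + 1) * τ ≤ N * τ := by
      have : (n : ℝ) + 1 ≤ N := by exact_mod_cast hnN
      gcongr
    obtain ⟨x1, x2⟩ := hξ
    obtain ⟨z1, z2⟩ := hζ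
    rw [hA, e1, e2]
    refine (abs_cpKernel_sub_le ω γ hρ hα (T := T) (C := C) (a := t₀ / 2) (by positivity)
      (fun t ht => (hC t ht).2) hC0.le ⟨?_, ?_⟩ ⟨?_, ?_⟩).trans ?_
    · linarith
    · linarith
    · linarith
    · linarith
    · refine mul_le_mul_of_nonneg_left ?_ hB0.le
      rw [abs_le]
      constructor <;> linarith
  have hqm : ∀ n : ℕ, m ≤ n → 2 * B * T * q ^ n ≤ 1 := by
    intro n hn
    have hnR : (m : ℝ) * τ ≤ n * τ := by
      have : (m : ℝ) ≤ n := by exact_mod_cast hn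
      gcongr
    have h1 : 2 * B * T ≤ l * (n * τ) := by
      have h2 : l * (t₀ / 2) = 2 * B * T := by rw [hl]; field_simp
      rw [← h2]
      exact mul_le_mul_of_nonneg_left (by linarith) hl0.le
    rw [hqn, Real.exp_neg, ← div_eq_mul_inv, div_le_one (Real.exp_pos _)]
    linarith [Real.add_one_le_exp (l * (n * τ))]
  -- Before `m` the differences have a sign and will telescope; from `m` on each term is at most
  -- `1/N`, which sums to at most `1`.
  have hterm : ∀ n ∈ Finset.Icc 1 (N - 1), |A n - A (n + 1)| * q ^ n
      ≤ (if n < m then A n - A (n + 1) else 0) + 1 / N := by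
    intro n hn
    obtain ⟨hn1, hn2⟩ := Finset.mem_Icc.1 hn
    have hqpos : 0 < q := Real.exp_pos _
    split_ifs with hnm
    · have h1 := hdec n hn1 hnm
      rw [abs_of_nonneg (sub_nonneg.2 h1)]
      have h2 : (A n - A (n + 1)) * q ^ n ≤ A n - A (n + 1) :=
        mul_le_of_le_one_right (sub_nonneg.2 h1) (pow_le_one₀ hqpos.le hq1)
      have : 0 < 1 / (N : ℝ) := by positivity
      linarith
    · have h1 := htail n (by omega) (by omega)
      have h2 := hqm n (by omega)
      calc |A n - A (n + 1)| * q ^ n ≤ B * (2 * τ) * q ^ n := by gcongr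
        _ = (2 * B * T * q ^ n) / N := by rw [hτdef]; ring
        _ ≤ 1 / N := by gcongr
        _ = 0 + 1 / N := by ring
  have htel : ∀ j : ℕ, ∑ n ∈ Finset.Icc 1 j, (if n < m then A n - A (n + 1) else 0)
      ≤ A 1 - A (min (j + 1) m) := by
    intro j
    induction j with
    | zero => rw [min_eq_left (by omega)]; simp
    | succ j ih =>
      rw [Finset.sum_Icc_succ_top (by omega)]
      split_ifs with h
      · rw [min_eq_left (by omega)] at ih ⊢
        linarith
      · rw [min_eq_right (by omega)] at ih ⊢
        linarith
  have hsum := Finset.sum_le_sum hterm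
  rw [Finset.sum_add_distrib, Finset.sum_const, nsmul_eq_mul, Nat.card_Icc] at hsum
  have h1 := htel (N - 1)
  rw [min_eq_right (by omega)] at h1
  have h2 : ((N - 1 + 1 - 1 : ℕ) : ℝ) * (1 / N) ≤ 1 := by
    rw [mul_one_div, div_le_one hNpos]
    exact_mod_cast (by omega)
  linarith

end Weights

/-- A sufficiently small geometric weight makes the Volterra operator coercive. -/
lemma exists_weight_of_pos {A : ℕ → ℝ} (hA : 0 < A 1) (N : ℕ) : ∃ q : ℝ, 0 < q ∧ q ≤ 1 ∧
    0 + A 1 / 2 ≤ A 1 - ∑ n ∈ Finset.Icc 1 (N - 1), |A n - A (n + 1)| * q ^ n := by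
  set S := ∑ n ∈ Finset.Icc 1 (N - 1), |A n - A (n + 1)|
  have hS : 0 ≤ S := Finset.sum_nonneg fun _ _ => abs_nonneg _
  -- Every exponent in the sum is at least `1`, so the sum is at most `S q ≤ A_1/2`. No lower bound
  -- on `q` uniform in `N` is claimed.
  set q := A 1 / (2 * S + A 1) with hq
  have hq0 : 0 < q := by positivity
  have hq1 : q ≤ 1 := by rw [hq, div_le_one (by positivity)]; linarith
  have hle : ∑ n ∈ Finset.Icc 1 (N - 1), |A n - A (n + 1)| * q ^ n ≤ S * q := by
    rw [Finset.sum_mul]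
    refine Finset.sum_le_sum fun n hn => mul_le_mul_of_nonneg_left ?_ (abs_nonneg _)
    exact pow_le_of_le_one hq0.le hq1 (by have := (Finset.mem_Icc.1 hn).1; omega)
  have hSq : S * q ≤ A 1 / 2 := by
    rw [hq, ← mul_div_assoc, div_le_iff₀ (by positivity)]
    nlinarith
  exact ⟨q, hq0, hq1, by linarith⟩

/-! ### Truncation error of the discrete derivative -/

section Truncation

variable {ρ α : ℝ} (ω γ : ℝ) (hρ : 0 < ρ) (hα : 0 < α ∧ α < 1)
include hρ hα

lemma intervalIntegrable_cpKernel (a b : ℝ) :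
    IntervalIntegrable (cpKernel ρ α ω γ) volume a b := by
  have h0 : Continuous fun t : ℝ => ω * t ^ ρ :=
    continuous_const.mul (Real.continuous_rpow_const hρ.le)
  have h1 := (differentiable_prabhakar (ρ := ρ) (β := 1 - α) (-γ) hρ (by linarith)).continuous
  exact (intervalIntegral.intervalIntegrable_rpow' (by linarith)).mul_continuousOn
    (h1.comp h0).continuousOn

lemma integral_cpKernel {a b : ℝ} (ha : 0 ≤ a) (hab : a ≤ b) :
    ∫ u in a..b, cpKernel ρ α ω γ u = cpKernelPrim ρ α ω γ b - cpKernelPrim ρ α ω γ a :=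
  intervalIntegral.integral_eq_sub_of_hasDerivAt_of_le hab
    (continuous_cpKernelPrim ω γ hρ hα).continuousOn
    (fun _ hx => hasDerivAt_cpKernelPrim ω γ hρ hα (ha.trans_lt hx.1))
    (intervalIntegrable_cpKernel ω γ hρ hα a b)

/-! ### Quadrature error on one time cell. -/

section OneInterval

variable {T B C a b t : ℝ} {g G : ℝ → ℝ}
  (hg : ∀ s ∈ Icc 0 T, HasDerivWithinAt g (G s) (Icc 0 T) s)
  (hG : ∀ s ∈ Icc 0 T, ∀ r ∈ Icc 0 T, |G s - G r| ≤ B * |s - r|)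
  (ha : 0 ≤ a) (hab : a < b) (hbt : b ≤ t) (htT : t ≤ T)

omit hρ hα in
include hG in
lemma continuousOn_of_lipschitz_bound : ContinuousOn G (Icc 0 T) := by
  have h : LipschitzOnWith B.toNNReal G (Icc 0 T) := by
    refine LipschitzOnWith.of_dist_le_mul fun s hs r hr => ?_
    rw [Real.dist_eq, Real.dist_eq]
    refine (hG s hs r hr).trans ?_
    exact mul_le_mul_of_nonneg_right (Real.le_coe_toNNReal B) (abs_nonneg _)
  exact h.continuousOn

omit hρ hα in
include hG ha hab hbt htT in
lemma continuousOn_comp_sub : ContinuousOn (fun u => G (t - u)) (uIcc a b) := by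
  rw [uIcc_of_le hab.le]
  refine (continuousOn_of_lipschitz_bound hG).comp (by fun_prop) fun u hu => ?_
  exact ⟨by linarith [hu.2], by linarith [hu.1]⟩

omit hρ hα in
include hg ha hbt htT in
lemma continuousOn_and_hasDerivAt_shift :
    ContinuousOn g (Icc (t - b) (t - a)) ∧ ∀ s ∈ Ioo (t - b) (t - a), HasDerivAt g (G s) s := by
  have hsub : Icc (t - b) (t - a) ⊆ Icc 0 T := Icc_subset_Icc (by linarith) (by linarith)
  refine ⟨fun s hs => ((hg s (hsub hs)).continuousWithinAt).mono hsub, fun s hs => ?_⟩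
  exact (hg s (hsub (Ioo_subset_Icc_self hs))).hasDerivAt
    (Icc_mem_nhds (by linarith [hs.1]) (by linarith [hs.2]))

omit hρ hα in
include hg hG ha hab hbt htT in
lemma abs_slope_sub_le {u : ℝ} (hu : u ∈ Icc a b) :
    |(g (t - a) - g (t - b)) / (b - a) - G (t - u)| ≤ B * (b - a) := by
  obtain ⟨hc, hd⟩ := continuousOn_and_hasDerivAt_shift hg ha hbt htT
  obtain ⟨ξ, hξ, e⟩ := exists_hasDerivAt_eq_slope g G (by linarith) hc hd
  have e' : (g (t - a) - g (t - b)) / (b - a) = G ξ := by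
    rw [e]; congr 1; ring
  have hB : 0 ≤ B := by
    by_contra hB
    have h1 := hG 0 ⟨le_rfl, by linarith⟩ T ⟨by linarith, le_rfl⟩
    have h2 := abs_nonneg (G 0 - G T)
    have h3 : 0 < |0 - T| := abs_pos.2 (by linarith)
    nlinarith
  rw [e']
  refine (hG ξ ⟨by linarith [hξ.1], by linarith [hξ.2]⟩ (t - u)
    ⟨by linarith [hu.2], by linarith [hu.1]⟩).trans (mul_le_mul_of_nonneg_left ?_ hB)
  rw [abs_le]
  constructor <;> linarith [hξ.1, hξ.2, hu.1, hu.2]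

include hG ha hab hbt htT in
lemma interval_error_eq (s : ℝ) :
    (cpKernelPrim ρ α ω γ b - cpKernelPrim ρ α ω γ a) * s
        - ∫ u in a..b, cpKernel ρ α ω γ u * G (t - u)
      = ∫ u in a..b, cpKernel ρ α ω γ u * (s - G (t - u)) := by
  have hk := intervalIntegrable_cpKernel ω γ hρ hα a b
  rw [← integral_cpKernel ω γ hρ hα ha hab.le, ← intervalIntegral.integral_mul_const,
    ← intervalIntegral.integral_sub (hk.mul_const s)
      (hk.mul_continuousOn (continuousOn_comp_sub hG ha hab hbt htT))]
  exact intervalIntegral.integral_congr fun u _ => by ring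

include hg hG hab hbt htT in
-- Next to the singularity no cancellation is used: the kernel integrates to order `b^{1-α}`, and
-- slope minus `G` is at most `B b`.
lemma first_interval_error (ha0 : a = 0)
    (hC : ∀ u ∈ Ioc 0 T, |cpKernel ρ α ω γ u| ≤ C * u ^ (-α)) :
    |(cpKernelPrim ρ α ω γ b - cpKernelPrim ρ α ω γ a) * ((g (t - a) - g (t - b)) / (b - a))
        - ∫ u in a..b, cpKernel ρ α ω γ u * G (t - u)|
      ≤ C / (1 - α) * B * b ^ (2 - α) := by
  subst ha0
  rw [interval_error_eq ω γ hρ hα hG le_rfl hab hbt htT]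
  have hI : IntervalIntegrable (fun u : ℝ => C * u ^ (-α) * (B * b)) volume 0 b :=
    ((intervalIntegral.intervalIntegrable_rpow' (by linarith)).const_mul C).mul_const _
  have h1 : ‖∫ u in (0 : ℝ)..b,
      cpKernel ρ α ω γ u * ((g (t - 0) - g (t - b)) / (b - 0) - G (t - u))‖
      ≤ ∫ u in (0 : ℝ)..b, C * u ^ (-α) * (B * b) := by
    refine intervalIntegral.norm_integral_le_of_norm_le hab.le (.of_forall fun u hu => ?_) hI
    rw [Real.norm_eq_abs, abs_mul]
    have h2 := abs_slope_sub_le hg hG le_rfl hab hbt htT (Ioc_subset_Icc_self hu)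
    rw [sub_zero b] at h2 ⊢
    have h3 := hC u ⟨hu.1, by linarith [hu.2]⟩
    exact mul_le_mul h3 h2 (abs_nonneg _) ((abs_nonneg _).trans h3)
  refine h1.trans (le_of_eq ?_)
  rw [intervalIntegral.integral_mul_const, intervalIntegral.integral_const_mul,
    integral_rpow (Or.inl (by linarith)), show -α + 1 = 1 - α by ring,
    Real.zero_rpow (by linarith), show 2 - α = (1 - α) + 1 by ring, Real.rpow_add_one hab.ne']
  have : 1 - α ≠ 0 := by linarith
  field_simp
  ring

include hg hG hab hbt htT in
-- Slope minus `G` has mean zero over the cell, so the kernel may be replaced by its variation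
-- there, which gains one power of the cell length.
lemma later_interval_error (ha0 : 0 < a) (hC0 : 0 ≤ C)
    (hC : ∀ u ∈ Ioc 0 T,
      |u ^ (-α - 1) * cpKernelDerivFactor ρ α ω γ u| ≤ C * u ^ (-α - 1)) :
    |(cpKernelPrim ρ α ω γ b - cpKernelPrim ρ α ω γ a) * ((g (t - a) - g (t - b)) / (b - a))
        - ∫ u in a..b, cpKernel ρ α ω γ u * G (t - u)|
      ≤ C * B * a ^ (-α - 1) * (b - a) ^ 3 := by
  rw [interval_error_eq ω γ hρ hα hG ha0.le hab hbt htT]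
  set s := (g (t - a) - g (t - b)) / (b - a) with hs
  have hk := intervalIntegrable_cpKernel (ρ := ρ) (α := α) ω γ hρ hα a b
  have hGc := continuousOn_comp_sub hG ha0.le hab hbt htT
  have hGi : IntervalIntegrable (fun u => G (t - u)) volume a b := hGc.intervalIntegrable
  have hzero : ∫ u in a..b, (s - G (t - u)) = 0 := by
    obtain ⟨hc, hd⟩ := continuousOn_and_hasDerivAt_shift hg ha0.le hbt htT
    have hGi' : IntervalIntegrable G volume (t - b) (t - a) := by
      refine ((continuousOn_of_lipschitz_bound hG).mono ?_).intervalIntegrable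
      rw [uIcc_of_le (by linarith)]
      exact Icc_subset_Icc (by linarith) (by linarith)
    rw [intervalIntegral.integral_sub intervalIntegrable_const hGi,
      intervalIntegral.integral_const, intervalIntegral.integral_comp_sub_left G t,
      intervalIntegral.integral_eq_sub_of_hasDerivAt_of_le (by linarith) hc hd hGi', hs,
      smul_eq_mul]
    have : b - a ≠ 0 := by linarith
    field_simp
    ring
  have hsub : ∫ u in a..b, cpKernel ρ α ω γ u * (s - G (t - u))
      = ∫ u in a..b, (cpKernel ρ α ω γ u - cpKernel ρ α ω γ a) * (s - G (t - u)) := by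
    have : ∀ u, (cpKernel ρ α ω γ u - cpKernel ρ α ω γ a) * (s - G (t - u))
      = cpKernel ρ α ω γ u * (s - G (t - u)) - cpKernel ρ α ω γ a * (s - G (t - u)) :=
      fun u => by ring
    simp only [this]
    have i1 : IntervalIntegrable (fun u => cpKernel ρ α ω γ u * (s - G (t - u))) volume a b :=
      hk.mul_continuousOn (continuousOn_const.sub hGc)
    have i2 : IntervalIntegrable (fun u => cpKernel ρ α ω γ a * (s - G (t - u))) volume a b :=
      (intervalIntegrable_const.sub hGi).const_mul _
    rw [intervalIntegral.integral_sub i1 i2, intervalIntegral.integral_const_mul,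
      hzero, mul_zero, sub_zero]
  rw [hsub]
  have h1 := intervalIntegral.norm_integral_le_of_norm_le_const (a := a) (b := b)
    (f := fun u => (cpKernel ρ α ω γ u - cpKernel ρ α ω γ a) * (s - G (t - u)))
    (C := C * a ^ (-α - 1) * (b - a) * (B * (b - a))) (fun u hu => by
      rw [uIoc_of_le hab.le] at hu
      rw [Real.norm_eq_abs, abs_mul]
      have h2 := abs_slope_sub_le hg hG ha0.le hab hbt htT (Ioc_subset_Icc_self hu)
      have h3 := abs_cpKernel_sub_le ω γ hρ hα ha0 hC hC0
        (x := u) (y := a) ⟨hu.1.le, by linarith [hu.2]⟩ ⟨le_rfl, by linarith⟩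
      have h4 : |u - a| ≤ b - a := by rw [abs_of_pos (by linarith [hu.1])]; linarith [hu.2]
      refine mul_le_mul (h3.trans ?_) h2 (abs_nonneg _) ?_
      · exact mul_le_mul_of_nonneg_left h4 (by positivity)
      · have : 0 ≤ b - a := by linarith
        positivity)
  rw [Real.norm_eq_abs, abs_of_pos (sub_pos.2 hab)] at h1
  refine h1.trans (le_of_eq (by ring))

end OneInterval

/-- The discrete derivative approximates the Caputo--Prabhakar convolution to order `2 - α`. -/
lemma exists_truncation_bound {T : ℝ} (hT : 0 < T) : ∃ K, 0 < K ∧ ∀ (B : ℝ) (g G : ℝ → ℝ), 0 ≤ B →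
    (∀ s ∈ Icc 0 T, HasDerivWithinAt g (G s) (Icc 0 T) s) →
    (∀ s ∈ Icc 0 T, ∀ r ∈ Icc 0 T, |G s - G r| ≤ B * |s - r|) →
    ∀ N k : ℕ, 1 ≤ k → k ≤ N →
      |discreteCP ρ α ω γ (T / N) (fun j => g (j * (T / N))) k
        - ∫ u in (0 : ℝ)..(k * (T / N)), cpKernel ρ α ω γ u * G (k * (T / N) - u)|
      ≤ K * B * (T / N) ^ (2 - α) := by
  obtain ⟨C, hC0, hC⟩ := exists_cpKernel_bound ω γ hρ hα T
  have hsm : Summable fun n : ℕ => (n : ℝ) ^ (-α - 1) :=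
    Real.summable_nat_rpow.2 (by linarith)
  have hs0 : 0 ≤ ∑' n : ℕ, (n : ℝ) ^ (-α - 1) := tsum_nonneg fun n => by positivity
  have h1α : 0 < 1 - α := by linarith
  -- The first cell gives `C/(1-α)`. Cell `m ≥ 1` gives `C (mτ)^{-α-1} τ³ = C m^{-α-1} τ^{2-α}`, and
  -- the series converges since `α > 0`.
  refine ⟨C / (1 - α) + C * ∑' n : ℕ, (n : ℝ) ^ (-α - 1), by positivity,
    fun B g G hB hg hG N k hk hkN => ?_⟩
  have hN : (0 : ℝ) < N := by exact_mod_cast (by omega)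
  set τ := T / N with hτdef
  have hτ : 0 < τ := by positivity
  have hkT : k * τ ≤ T := by
    have h1 : (k : ℝ) * τ ≤ N * τ := by gcongr
    have h2 : N * τ = T := by rw [hτdef]; field_simp
    linarith
  have hcont : ContinuousOn (fun u => G (k * τ - u)) (Icc 0 (k * τ)) := by
    refine (continuousOn_of_lipschitz_bound hG).comp (by fun_prop) fun u hu => ?_
    exact ⟨by linarith [hu.2], by linarith [hu.1]⟩
  have hsplit : ∫ u in (0 : ℝ)..(k * τ), cpKernel ρ α ω γ u * G (k * τ - u)
      = ∑ m ∈ Finset.range k, ∫ u in (m * τ)..((m + 1 : ℕ) * τ),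
          cpKernel ρ α ω γ u * G (k * τ - u) := by
    rw [intervalIntegral.sum_integral_adjacent_intervals (a := fun m : ℕ => (m : ℝ) * τ)]
    · simp
    · intro m hm
      refine (intervalIntegrable_cpKernel ω γ hρ hα _ _).mul_continuousOn (hcont.mono ?_)
      have h1 : ((m + 1 : ℕ) : ℝ) * τ ≤ k * τ := by
        have : ((m + 1 : ℕ) : ℝ) ≤ k := by exact_mod_cast hm
        gcongr
      have h2 : (m : ℝ) * τ ≤ ((m + 1 : ℕ) : ℝ) * τ := by push_cast; linarith
      rw [uIcc_of_le h2]
      exact Icc_subset_Icc (by positivity) h1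
  rw [discreteCP_eq_sum_diff _ _ _ _ _ _ hk, hsplit, ← Finset.sum_sub_distrib]
  have hterm : ∀ m ∈ Finset.range k,
      |cpWeight ρ α ω γ τ (m + 1) * (g ((k - m : ℕ) * τ) - g ((k - (m + 1) : ℕ) * τ))
        - ∫ u in (m * τ)..((m + 1 : ℕ) * τ), cpKernel ρ α ω γ u * G (k * τ - u)|
      ≤ (if m = 0 then C / (1 - α) * B * τ ^ (2 - α) else 0)
        + C * (m : ℝ) ^ (-α - 1) * B * τ ^ (2 - α) := by
    intro m hm
    have hmk := Finset.mem_range.1 hm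
    have e1 : ((k - m : ℕ) : ℝ) * τ = k * τ - m * τ := by
      rw [Nat.cast_sub hmk.le]; ring
    have e2 : ((k - (m + 1) : ℕ) : ℝ) * τ = k * τ - (m + 1 : ℕ) * τ := by
      rw [Nat.cast_sub (by omega)]; ring
    have e3 : ((m + 1 : ℕ) : ℝ) * τ - m * τ = τ := by push_cast; ring
    have e4 : cpWeight ρ α ω γ τ (m + 1) * (g (k * τ - m * τ) - g (k * τ - (m + 1 : ℕ) * τ))
        = (cpKernelPrim ρ α ω γ ((m + 1 : ℕ) * τ) - cpKernelPrim ρ α ω γ (m * τ))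
          * ((g (k * τ - m * τ) - g (k * τ - (m + 1 : ℕ) * τ)) / ((m + 1 : ℕ) * τ - m * τ)) := by
      rw [cpWeight, coeff_eq _ _ _ _ hτ (by omega), e3]
      push_cast
      rw [add_sub_cancel_right]
      ring
    have hab : (m : ℝ) * τ < (m + 1 : ℕ) * τ := by linarith
    have hbt : ((m + 1 : ℕ) : ℝ) * τ ≤ k * τ := by
      have : ((m + 1 : ℕ) : ℝ) ≤ k := by exact_mod_cast hmk
      gcongr
    rw [e1, e2, e4]
    split_ifs with h0
    · subst h0
      have := first_interval_error ω γ hρ hα hg hG hab hbt hkT (by simp)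
        (fun u hu => (hC u hu).1)
      refine this.trans ?_
      have h2 : 0 ≤ C * ((0 : ℕ) : ℝ) ^ (-α - 1) * B * τ ^ (2 - α) := by positivity
      simp only [zero_add, Nat.cast_one, one_mul] at h2 ⊢
      exact le_add_of_nonneg_right h2
    · have hm0 : (0 : ℝ) < m := by exact_mod_cast Nat.pos_of_ne_zero h0
      have := later_interval_error ω γ hρ hα hg hG hab hbt hkT (by positivity) hC0.le
        (fun u hu => (hC u hu).2)
      refine this.trans (le_of_eq ?_)
      rw [e3, Real.mul_rpow hm0.le hτ.le, show 2 - α = (-α - 1) + 3 by ring, Real.rpow_add hτ]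
      norm_cast
      ring
  refine (Finset.abs_sum_le_sum_abs _ _).trans ((Finset.sum_le_sum hterm).trans ?_)
  rw [Finset.sum_add_distrib, Finset.sum_ite_eq' (Finset.range k) 0, if_pos (Finset.mem_range.2 hk)]
  have h5 : ∑ m ∈ Finset.range k, C * (m : ℝ) ^ (-α - 1) * B * τ ^ (2 - α)
      ≤ C * (∑' n : ℕ, (n : ℝ) ^ (-α - 1)) * B * τ ^ (2 - α) := by
    rw [← Finset.sum_mul, ← Finset.sum_mul, ← Finset.mul_sum]
    have := hsm.sum_le_tsum (Finset.range k) (fun n _ => by positivity)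
    gcongr
  linarith

/-! ### The derivative as a convolution, and its limit at the final time. -/

omit hρ hα in
lemma cpDeriv_eq_convolution {T t : ℝ} {g G : ℝ → ℝ} (ht : t ∈ Icc 0 T)
    (hg : ∀ s ∈ Icc 0 T, HasDerivWithinAt g (G s) (Icc 0 T) s) :
    cpDeriv ρ α ω γ g t = ∫ u in (0 : ℝ)..t, cpKernel ρ α ω γ u * G (t - u) := by
  have h1 := intervalIntegral.integral_comp_sub_left (a := 0) (b := t)
    (fun s => cpKernel ρ α ω γ (t - s) * G s) t
  simp only [sub_sub_cancel, sub_self, sub_zero] at h1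
  rw [h1, cpDeriv, intervalIntegral.integral_of_le ht.1, intervalIntegral.integral_of_le ht.1,
    -- Endpoints are discarded because the two-sided `deriv` is known to agree with `G` only in the
    -- interior.
    integral_Ioc_eq_integral_Ioo, integral_Ioc_eq_integral_Ioo]
  refine setIntegral_congr_fun measurableSet_Ioo fun s hs => ?_
  have h2 : HasDerivAt g (G s) s := (hg s ⟨hs.1.le, hs.2.le.trans ht.2⟩).hasDerivAt
    (Icc_mem_nhds hs.1 (hs.2.trans_le ht.2))
  simp only [h2.deriv, cpKernel]

/-- The Caputo--Prabhakar convolution is continuous up to the final time. -/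
lemma tendsto_convolution {T : ℝ} (hT : 0 < T) {G : ℝ → ℝ} (hG : ContinuousOn G (Icc 0 T)) :
    Tendsto (fun t => ∫ u in (0 : ℝ)..t, cpKernel ρ α ω γ u * G (t - u)) (𝓝[Ioo 0 T] T)
      (𝓝 (∫ u in (0 : ℝ)..T, cpKernel ρ α ω γ u * G (T - u))) := by
  -- Extending `G` by constants makes the integrand meaningful on all of `[0, T]`. Then `∫₀ᵗ = ∫₀ᵀ -
  -- ∫ₜᵀ`: the first is continuous by dominated convergence, the second tends to `0`.
  set G' := IccExtend hT.le (domRestrict (Icc 0 T) G) with hG'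
  have hc : Continuous G' := hG.domRestrict.Icc_extend'
  have heq : ∀ s ∈ Icc 0 T, G' s = G s := fun s hs => by
    rw [hG', IccExtend_of_mem _ _ hs]; rfl
  obtain ⟨B, hB⟩ : ∃ B, ∀ s, ‖G' s‖ ≤ B := by
    obtain ⟨B, hB⟩ := isCompact_Icc.exists_bound_of_continuousOn hG
    exact ⟨B, fun s => hB _ (projIcc 0 T hT.le s).2⟩
  have hk := intervalIntegrable_cpKernel (ρ := ρ) (α := α) ω γ hρ hα
  have hcs : ∀ t, Continuous fun u => G' (t - u) := fun t => hc.comp (by fun_prop)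
  have hint : ∀ t a b, IntervalIntegrable (fun u => cpKernel ρ α ω γ u * G' (t - u)) volume a b :=
    fun t a b => (hk a b).mul_continuousOn (hcs t).continuousOn
  have hbound : ∀ t u, ‖cpKernel ρ α ω γ u * G' (t - u)‖ ≤ ‖cpKernel ρ α ω γ u‖ * B :=
    fun t u => by rw [norm_mul]; gcongr; exact hB _
  have h1 : Continuous fun t => ∫ u in (0 : ℝ)..T, cpKernel ρ α ω γ u * G' (t - u) := by
    refine intervalIntegral.continuous_of_dominated_interval
      (bound := fun u => ‖cpKernel ρ α ω γ u‖ * B) (fun t => ?_) (fun t => ?_)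
      ((hk 0 T).norm.mul_const B) (.of_forall fun u _ => ?_)
    · exact (hint t 0 T).aestronglyMeasurable_restrict_uIoc
    · exact .of_forall fun u _ => hbound t u
    · exact continuous_const.mul (hc.comp (by fun_prop))
  have h2 : Tendsto (fun t => ∫ u in t..T, ‖cpKernel ρ α ω γ u‖ * B) (𝓝[Ioo 0 T] T) (𝓝 0) := by
    have hi : ∀ a b, IntervalIntegrable (fun u => ‖cpKernel ρ α ω γ u‖ * B) volume a b :=
      fun a b => (hk a b).norm.mul_const B
    have := (intervalIntegral.continuous_primitive hi T).tendsto T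
    rw [intervalIntegral.integral_same] at this
    have h3 := (this.mono_left (nhdsWithin_le_nhds (s := Ioo 0 T))).neg
    rw [neg_zero] at h3
    refine h3.congr fun t => ?_
    rw [intervalIntegral.integral_symm]
    ring
  have h3 : Tendsto (fun t => ∫ u in t..T, cpKernel ρ α ω γ u * G' (t - u)) (𝓝[Ioo 0 T] T)
      (𝓝 0) := by
    refine squeeze_zero_norm' ?_ h2
    filter_upwards [self_mem_nhdsWithin] with t ht
    exact intervalIntegral.norm_integral_le_of_norm_le ht.2.le
      (.of_forall fun u _ => hbound t u) ((hk _ _).norm.mul_const B)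
  have h4 := ((h1.tendsto T).mono_left (nhdsWithin_le_nhds (s := Ioo 0 T))).sub h3
  rw [sub_zero] at h4
  have hlim : ∀ t ∈ Ioc 0 T, ∫ u in (0 : ℝ)..t, cpKernel ρ α ω γ u * G (t - u)
      = ∫ u in (0 : ℝ)..t, cpKernel ρ α ω γ u * G' (t - u) := by
    intro t ht
    refine intervalIntegral.integral_congr fun u hu => ?_
    rw [uIcc_of_le ht.1.le] at hu
    rw [heq _ ⟨by linarith [hu.2], by linarith [hu.1, ht.2]⟩]
  rw [hlim T ⟨hT, le_rfl⟩]
  refine h4.congr' ?_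
  filter_upwards [self_mem_nhdsWithin] with t ht
  rw [hlim t (Ioo_subset_Ioc_self ht), sub_eq_iff_eq_add,
    intervalIntegral.integral_add_adjacent_intervals (hint _ _ _) (hint _ _ _)]

end Truncation

/-! ### Taylor estimates for symmetric differences -/

/-- One integration of a Taylor remainder by the mean value inequality; the factor `1/(n+1)` is
given up. -/
lemma abs_le_mul_pow_succ {p p' : ℝ → ℝ} {h C : ℝ} {n : ℕ} (hC : 0 ≤ C) (h0 : p 0 = 0)
    (hp : ∀ s ∈ Icc 0 h, HasDerivWithinAt p (p' s) (Icc 0 h) s)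
    (hb : ∀ s ∈ Icc 0 h, |p' s| ≤ C * s ^ n) : ∀ s ∈ Icc 0 h, |p s| ≤ C * s ^ (n + 1) := by
  intro s hs
  have hsub : Icc 0 s ⊆ Icc 0 h := Icc_subset_Icc le_rfl hs.2
  have := (convex_Icc 0 s).norm_image_sub_le_of_norm_hasDerivWithin_le
    (f := p) (f' := p') (C := C * s ^ n) (fun r hr => (hp r (hsub hr)).mono hsub)
    (fun r hr => (hb r (hsub hr)).trans
      (mul_le_mul_of_nonneg_left (pow_le_pow_left₀ hr.1 hr.2 n) hC))
    (left_mem_Icc.2 hs.1) (right_mem_Icc.2 hs.1)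
  rw [h0, sub_zero, sub_zero, Real.norm_eq_abs, Real.norm_eq_abs, abs_of_nonneg hs.1] at this
  rw [pow_succ, ← mul_assoc]
  exact this

section SymmetricDifference

variable {L x h : ℝ}

lemma hasDerivWithinAt_add_shift {g g' : ℝ → ℝ}
    (hg : ∀ y ∈ Icc 0 L, HasDerivWithinAt g (g' y) (Icc 0 L) y) (hxl : 0 ≤ x - h)
    (hxr : x + h ≤ L) {s : ℝ} (hs : s ∈ Icc 0 h) :
    HasDerivWithinAt (fun r => g (x + r)) (g' (x + s)) (Icc 0 h) s := by
  have hm : MapsTo (fun r => x + r) (Icc 0 h) (Icc 0 L) := fun r hr =>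
    ⟨by linarith [hr.1, hr.2], by linarith [hr.2]⟩
  exact ((hg (x + s) (hm hs)).comp s ((hasDerivWithinAt_id s _).const_add x) hm).congr_deriv
    (by simp)

lemma hasDerivWithinAt_sub_shift {g g' : ℝ → ℝ}
    (hg : ∀ y ∈ Icc 0 L, HasDerivWithinAt g (g' y) (Icc 0 L) y) (hxl : 0 ≤ x - h)
    (hxr : x + h ≤ L) {s : ℝ} (hs : s ∈ Icc 0 h) :
    HasDerivWithinAt (fun r => g (x - r)) (-g' (x - s)) (Icc 0 h) s := by
  have hm : MapsTo (fun r => x - r) (Icc 0 h) (Icc 0 L) := fun r hr =>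
    ⟨by linarith [hr.2], by linarith [hr.1, hr.2]⟩
  exact ((hg (x - s) (hm hs)).comp s ((hasDerivWithinAt_id s _).const_sub x) hm).congr_deriv
    (by simp)

variable {g₀ g₁ g₂ g₃ : ℝ → ℝ} {B : ℝ}

/-- Differentiate in the step `s`: the remainder and its first two `s`-derivatives vanish at `s =
0`, and the third is bounded by `2B`. -/
lemma abs_centralDiff_sub_le
    (h₀ : ∀ y ∈ Icc 0 L, HasDerivWithinAt g₀ (g₁ y) (Icc 0 L) y)
    (h₁ : ∀ y ∈ Icc 0 L, HasDerivWithinAt g₁ (g₂ y) (Icc 0 L) y)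
    (h₂ : ∀ y ∈ Icc 0 L, HasDerivWithinAt g₂ (g₃ y) (Icc 0 L) y)
    (hB : ∀ y ∈ Icc 0 L, |g₃ y| ≤ B) (hxl : 0 ≤ x - h) (hxr : x + h ≤ L) :
    ∀ s ∈ Icc 0 h, |g₀ (x + s) - g₀ (x - s) - 2 * s * g₁ x| ≤ 2 * B * s ^ 3 := by
  intro s hs
  have hx : x ∈ Icc 0 L := ⟨by linarith [hs.1, hs.2], by linarith [hs.1, hs.2]⟩
  have hB0 : 0 ≤ 2 * B := by linarith [(abs_nonneg _).trans (hB x hx)]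
  have b2 := abs_le_mul_pow_succ (p := fun r => g₂ (x + r) - g₂ (x - r))
    (p' := fun r => g₃ (x + r) - -g₃ (x - r)) (h := h) (n := 0) hB0 (by simp)
    (fun r hr => (hasDerivWithinAt_add_shift h₂ hxl hxr hr).sub
      (hasDerivWithinAt_sub_shift h₂ hxl hxr hr))
    (fun r hr => by
      have e1 := hB (x + r) ⟨by linarith [hr.1, hr.2], by linarith [hr.2]⟩
      have e2 := hB (x - r) ⟨by linarith [hr.2], by linarith [hr.1, hr.2]⟩
      rw [sub_neg_eq_add, pow_zero, mul_one]
      linarith [abs_add_le (g₃ (x + r)) (g₃ (x - r))])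
  have b1 := abs_le_mul_pow_succ (p := fun r => g₁ (x + r) + g₁ (x - r) - 2 * g₁ x)
    (p' := fun r => g₂ (x + r) + -g₂ (x - r)) (h := h) (n := 1) hB0 (by simp; ring)
    (fun r hr => ((hasDerivWithinAt_add_shift h₁ hxl hxr hr).add
      (hasDerivWithinAt_sub_shift h₁ hxl hxr hr)).sub_const _)
    (fun r hr => by rw [← sub_eq_add_neg]; exact b2 r hr)
  have b0 := abs_le_mul_pow_succ (p := fun r => g₀ (x + r) - g₀ (x - r) - 2 * r * g₁ x)
    (p' := fun r => g₁ (x + r) - -g₁ (x - r) - 2 * g₁ x) (h := h) (n := 2) hB0 (by simp)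
    (fun r hr => ((hasDerivWithinAt_add_shift h₀ hxl hxr hr).sub
      (hasDerivWithinAt_sub_shift h₀ hxl hxr hr)).sub
      (by simpa using ((hasDerivWithinAt_id r _).const_mul 2).mul_const (g₁ x)))
    (fun r hr => by rw [sub_neg_eq_add]; exact b1 r hr)
  exact b0 s hs

/-- The derivative in the step is the central-difference remainder of `g₁`. -/
lemma abs_secondDiff_sub_le {g₄ : ℝ → ℝ}
    (h₀ : ∀ y ∈ Icc 0 L, HasDerivWithinAt g₀ (g₁ y) (Icc 0 L) y)
    (h₁ : ∀ y ∈ Icc 0 L, HasDerivWithinAt g₁ (g₂ y) (Icc 0 L) y)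
    (h₂ : ∀ y ∈ Icc 0 L, HasDerivWithinAt g₂ (g₃ y) (Icc 0 L) y)
    (h₃ : ∀ y ∈ Icc 0 L, HasDerivWithinAt g₃ (g₄ y) (Icc 0 L) y)
    (hB : ∀ y ∈ Icc 0 L, |g₄ y| ≤ B) (hxl : 0 ≤ x - h) (hxr : x + h ≤ L) (hh : 0 ≤ h) :
    |g₀ (x + h) - 2 * g₀ x + g₀ (x - h) - h ^ 2 * g₂ x| ≤ 2 * B * h ^ 4 := by
  have hx : x ∈ Icc 0 L := ⟨by linarith, by linarith⟩
  have hB0 : 0 ≤ 2 * B := by linarith [(abs_nonneg _).trans (hB x hx)]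
  have b1 := abs_centralDiff_sub_le h₁ h₂ h₃ hB hxl hxr
  have b0 := abs_le_mul_pow_succ
    (p := fun r => g₀ (x + r) + g₀ (x - r) - 2 * g₀ x - r ^ 2 * g₂ x)
    (p' := fun r => g₁ (x + r) + -g₁ (x - r) - 2 * r * g₂ x) (h := h) (n := 3) hB0
    (by simp; ring)
    (fun r hr => (((hasDerivWithinAt_add_shift h₀ hxl hxr hr).add
      (hasDerivWithinAt_sub_shift h₀ hxl hxr hr)).sub_const _).sub
      (by simpa using ((hasDerivWithinAt_id r _).pow 2).mul_const (g₂ x)))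
    (fun r hr => by rw [← sub_eq_add_neg]; exact b1 r hr)
  have := b0 h ⟨hh, le_rfl⟩
  rwa [show g₀ (x + h) - 2 * g₀ x + g₀ (x - h) - h ^ 2 * g₂ x
    = g₀ (x + h) + g₀ (x - h) - 2 * g₀ x - h ^ 2 * g₂ x by ring]

end SymmetricDifference

/-! ### Partial derivatives on a closed rectangle -/

section Rectangle

variable {L T : ℝ}

/-- `Fx` is the partial derivative of `F` in the first variable on the closed rectangle. -/
def IsPartialX (L T : ℝ) (F Fx : ℝ × ℝ → ℝ) : Prop :=
  ∀ x ∈ Icc 0 L, ∀ t ∈ Icc 0 T, HasDerivWithinAt (fun y => F (y, t)) (Fx (x, t)) (Icc 0 L) x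

/-- `Ft` is the partial derivative of `F` in the second variable on the closed rectangle. -/
def IsPartialT (L T : ℝ) (F Ft : ℝ × ℝ → ℝ) : Prop :=
  ∀ x ∈ Icc 0 L, ∀ t ∈ Icc 0 T, HasDerivWithinAt (fun s => F (x, s)) (Ft (x, t)) (Icc 0 T) t

/-- The rectangle has unique derivatives, so the partials are `fderivWithin` applied to basis
vectors and cost one order of smoothness. -/
lemma exists_partials (hL : 0 < L) (hT : 0 < T) {F : ℝ × ℝ → ℝ} {m n : WithTop ℕ∞}
    (hF : ContDiffOn ℝ n F (Icc 0 L ×ˢ Icc 0 T)) (hmn : m + 1 ≤ n) :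
    ∃ Fx Ft : ℝ × ℝ → ℝ, ContDiffOn ℝ m Fx (Icc 0 L ×ˢ Icc 0 T) ∧
      ContDiffOn ℝ m Ft (Icc 0 L ×ˢ Icc 0 T) ∧ IsPartialX L T F Fx ∧ IsPartialT L T F Ft := by
  have hu : UniqueDiffOn ℝ (Icc 0 L ×ˢ Icc 0 T) :=
    (uniqueDiffOn_Icc hL).prod (uniqueDiffOn_Icc hT)
  have hd := hF.fderivWithin hu hmn
  have hn : n ≠ 0 := by
    rintro rfl
    simp at hmn
  have hdiff := hF.differentiableOn hn
  refine ⟨fun p => fderivWithin ℝ F (Icc 0 L ×ˢ Icc 0 T) p (1, 0),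
    fun p => fderivWithin ℝ F (Icc 0 L ×ˢ Icc 0 T) p (0, 1),
    hd.clm_apply contDiffOn_const, hd.clm_apply contDiffOn_const, fun x hx t ht => ?_,
    fun x hx t ht => ?_⟩
  · have h1 := (hdiff (x, t) ⟨hx, ht⟩).hasFDerivWithinAt
    have hm : MapsTo (fun y => (y, t)) (Icc 0 L) (Icc 0 L ×ˢ Icc 0 T) := fun y hy => ⟨hy, ht⟩
    exact h1.comp_hasDerivWithinAt x
      ((hasDerivWithinAt_id x (Icc 0 L)).prodMk (hasDerivWithinAt_const x _ t)) hm
  · have h1 := (hdiff (x, t) ⟨hx, ht⟩).hasFDerivWithinAt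
    have hm : MapsTo (fun s => (x, s)) (Icc 0 T) (Icc 0 L ×ˢ Icc 0 T) := fun s hs => ⟨hx, hs⟩
    exact h1.comp_hasDerivWithinAt t
      ((hasDerivWithinAt_const t _ x).prodMk (hasDerivWithinAt_id t (Icc 0 T))) hm

lemma exists_abs_le_on_rectangle {F : ℝ × ℝ → ℝ} (hF : ContinuousOn F (Icc 0 L ×ˢ Icc 0 T)) :
    ∃ B, 0 < B ∧ ∀ x ∈ Icc 0 L, ∀ t ∈ Icc 0 T, |F (x, t)| ≤ B := by
  obtain ⟨B, hB⟩ := (isCompact_Icc.prod isCompact_Icc).exists_bound_of_continuousOn hF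
  exact ⟨max B 1, by positivity, fun x hx t ht => (hB (x, t) ⟨hx, ht⟩).trans (le_max_left _ _)⟩

/-- Spatial derivatives together with the second order accuracy of symmetric differences. -/
lemma exists_spatial_estimates (hL : 0 < L) (hT : 0 < T) {F : ℝ × ℝ → ℝ}
    (hF : ContDiffOn ℝ 4 F (Icc 0 L ×ˢ Icc 0 T)) :
    ∃ (Fx Fxx : ℝ × ℝ → ℝ) (K : ℝ), ContinuousOn Fx (Icc 0 L ×ˢ Icc 0 T) ∧
      ContinuousOn Fxx (Icc 0 L ×ˢ Icc 0 T) ∧ IsPartialX L T F Fx ∧ IsPartialX L T Fx Fxx ∧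
      0 < K ∧ ∀ t ∈ Icc 0 T, ∀ x h : ℝ, 0 < h → 0 ≤ x - h → x + h ≤ L →
        |F (x + h, t) - F (x - h, t) - 2 * h * Fx (x, t)| ≤ K * h ^ 3 ∧
        |F (x + h, t) - 2 * F (x, t) + F (x - h, t) - h ^ 2 * Fxx (x, t)| ≤ K * h ^ 4 := by
  obtain ⟨F1, -, c1, -, p1, -⟩ := exists_partials hL hT (m := 3) hF (by norm_num)
  obtain ⟨F2, -, c2, -, p2, -⟩ := exists_partials hL hT (m := 2) c1 (by norm_num)
  obtain ⟨F3, -, c3, -, p3, -⟩ := exists_partials hL hT (m := 1) c2 (by norm_num)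
  obtain ⟨F4, -, c4, -, p4, -⟩ := exists_partials hL hT (m := 0) c3 (by norm_num)
  obtain ⟨B3, hB3, b3⟩ := exists_abs_le_on_rectangle c3.continuousOn
  obtain ⟨B4, hB4, b4⟩ := exists_abs_le_on_rectangle c4.continuousOn
  refine ⟨F1, F2, 2 * B3 + 2 * B4, c1.continuousOn, c2.continuousOn, p1, p2, by positivity,
    fun t ht x h hh hxl hxr => ⟨?_, ?_⟩⟩
  · have := abs_centralDiff_sub_le (fun y hy => p1 y hy t ht) (fun y hy => p2 y hy t ht)
      (fun y hy => p3 y hy t ht) (fun y hy => b3 y hy t ht) hxl hxr h ⟨hh.le, le_rfl⟩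
    refine this.trans (mul_le_mul_of_nonneg_right (by linarith) (by positivity))
  · have := abs_secondDiff_sub_le (fun y hy => p1 y hy t ht) (fun y hy => p2 y hy t ht)
      (fun y hy => p3 y hy t ht) (fun y hy => p4 y hy t ht) (fun y hy => b4 y hy t ht)
      hxl hxr hh.le
    refine this.trans (mul_le_mul_of_nonneg_right (by linarith) (by positivity))

lemma IsPartialX.hasDerivAt {F Fx : ℝ × ℝ → ℝ} (h : IsPartialX L T F Fx) {x t : ℝ}
    (hx : x ∈ Ioo 0 L) (ht : t ∈ Icc 0 T) : HasDerivAt (fun y => F (y, t)) (Fx (x, t)) x :=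
  (h x (Ioo_subset_Icc_self hx) t ht).hasDerivAt (Icc_mem_nhds hx.1 hx.2)

lemma IsPartialX.iteratedDeriv_two {F Fx Fxx : ℝ × ℝ → ℝ} (h : IsPartialX L T F Fx)
    (h' : IsPartialX L T Fx Fxx) {x t : ℝ} (hx : x ∈ Ioo 0 L) (ht : t ∈ Icc 0 T) :
    iteratedDeriv 2 (fun y => F (y, t)) x = Fxx (x, t) := by
  rw [iteratedDeriv_succ, iteratedDeriv_one, ← (h'.hasDerivAt hx ht).deriv]
  refine Filter.EventuallyEq.deriv_eq ?_
  filter_upwards [Ioo_mem_nhds hx.1 hx.2] with y hy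
  exact (h.hasDerivAt hy ht).deriv

lemma IsPartialT.lipschitz {F Ft : ℝ × ℝ → ℝ} {B : ℝ} (h : IsPartialT L T F Ft)
    (hB : ∀ x ∈ Icc 0 L, ∀ t ∈ Icc 0 T, |Ft (x, t)| ≤ B) {x : ℝ} (hx : x ∈ Icc 0 L) :
    ∀ s ∈ Icc 0 T, ∀ r ∈ Icc 0 T, |F (x, s) - F (x, r)| ≤ B * |s - r| := by
  intro s hs r hr
  exact (convex_Icc 0 T).norm_image_sub_le_of_norm_hasDerivWithin_le (f := fun t => F (x, t))
    (fun t ht => h x hx t ht) (fun t ht => hB x hx t ht) hr hs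

end Rectangle

/-! ### Consistency and convergence of the scheme -/

lemma gridNormSq_nonneg {h : ℝ} (hh : 0 ≤ h) (M : ℕ) (w : ℕ → ℝ) : 0 ≤ gridNormSq h M w :=
  Finset.sum_nonneg fun i _ => by positivity

lemma node_mem_Icc {L : ℝ} {M i : ℕ} (hL : 0 ≤ L) (hM : 1 ≤ M) (hi : i ≤ M) :
    (i : ℝ) * (L / M) ∈ Icc 0 L := by
  have hM' : (0 : ℝ) < M := by exact_mod_cast hM
  have hi' : (i : ℝ) ≤ M := by exact_mod_cast hi
  refine ⟨by positivity, ?_⟩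
  rw [← mul_div_assoc, div_le_iff₀ hM', mul_comm L]
  gcongr

lemma cast_mul_div_cancel {M : ℕ} (L : ℝ) (hM : 1 ≤ M) : (M : ℝ) * (L / M) = L := by
  have hM' : (0 : ℝ) < M := by exact_mod_cast hM
  field_simp

section Solution

variable {ρ α ω γ L T : ℝ} {f : ℝ → ℝ → ℝ} {φ : ℝ → ℝ} {v : ℝ → ℝ → ℝ}
  (hL : 0 < L) (hT : 0 < T) (hv : IsExactSolution ρ α ω γ L T f φ v)

include hT hv in
lemma boundary_zero {n : WithTop ℕ∞}
    (hsmooth : ContDiffOn ℝ n (fun p : ℝ × ℝ => v p.1 p.2) (Icc 0 L ×ˢ Icc 0 T)) (hL : 0 < L) :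
    ∀ t ∈ Icc 0 T, v 0 t = 0 ∧ v L t = 0 := by
  have hcl : Icc 0 T ⊆ closure (Ioo 0 T) := by rw [closure_Ioo hT.ne]
  have hslice : ∀ x ∈ Icc 0 L, ContinuousOn (fun t => v x t) (Icc 0 T) := fun x hx =>
    hsmooth.continuousOn.comp (f := fun t => (x, t)) (by fun_prop) fun t ht => ⟨hx, ht⟩
  have key : ∀ x ∈ Icc 0 L, (∀ t ∈ Ioo 0 T, v x t = 0) → ∀ t ∈ Icc 0 T, v x t = 0 :=
    fun x hx h => Set.EqOn.of_subset_closure (g := fun _ => (0 : ℝ)) h (hslice x hx)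
      continuousOn_const Ioo_subset_Icc_self hcl
  exact fun t ht => ⟨key 0 (left_mem_Icc.2 hL.le) (fun s hs => (hv.boundary s hs).1) t ht,
    key L (right_mem_Icc.2 hL.le) (fun s hs => (hv.boundary s hs).2) t ht⟩

include hT hv in
/-- The equation in convolution form holds up to the final time. -/
lemma convolution_equation (hρ : 0 < ρ) (hα : 0 < α ∧ α < 1)
    (hf : ContinuousOn (fun p : ℝ × ℝ => f p.1 p.2) (Icc 0 L ×ˢ Icc 0 T))
    (hvc : ContinuousOn (fun p : ℝ × ℝ => v p.1 p.2) (Icc 0 L ×ˢ Icc 0 T))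
    {Fx Fxx Ft : ℝ × ℝ → ℝ} (cx : ContinuousOn Fx (Icc 0 L ×ˢ Icc 0 T))
    (cxx : ContinuousOn Fxx (Icc 0 L ×ˢ Icc 0 T)) (ct : ContinuousOn Ft (Icc 0 L ×ˢ Icc 0 T))
    (px : IsPartialX L T (fun p => v p.1 p.2) Fx) (pxx : IsPartialX L T Fx Fxx)
    (pt : IsPartialT L T (fun p => v p.1 p.2) Ft) {x t : ℝ} (hx : x ∈ Ioo 0 L)
    (ht : t ∈ Ioc 0 T) :
    (∫ u in (0 : ℝ)..t, cpKernel ρ α ω γ u * Ft (x, t - u)) + v x t * Fx (x, t)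
      = Fxx (x, t) + f x t := by
  have hx' := Ioo_subset_Icc_self hx
  have hinner : ∀ s ∈ Ioo 0 T, (∫ u in (0 : ℝ)..s, cpKernel ρ α ω γ u * Ft (x, s - u))
      + v x s * Fx (x, s) = Fxx (x, s) + f x s := by
    intro s hs
    have hs' := Ioo_subset_Icc_self hs
    have h1 := hv.equation x hx s hs
    rwa [cpDeriv_eq_convolution ω γ (G := fun r => Ft (x, r)) hs' (pt x hx'),
      (px.hasDerivAt hx hs').deriv, px.iteratedDeriv_two pxx hx hs'] at h1
  -- The equation is given only for `t < T`, but the last time level is `t_N = T`; it is reached by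
  -- a limit.
  rcases ht.2.eq_or_lt with rfl | htT
  · have hslice : ∀ F : ℝ × ℝ → ℝ, ContinuousOn F (Icc 0 L ×ˢ Icc 0 t) →
        ContinuousOn (fun s => F (x, s)) (Icc 0 t) := fun F hF =>
      hF.comp (f := fun s => (x, s)) (by fun_prop) fun s hs => ⟨hx', hs⟩
    have hlim : ∀ F : ℝ × ℝ → ℝ, ContinuousOn F (Icc 0 L ×ˢ Icc 0 t) →
        Tendsto (fun s => F (x, s)) (𝓝[Ioo 0 t] t) (𝓝 (F (x, t))) := fun F hF =>
      ((hslice F hF t (right_mem_Icc.2 hT.le)).mono Ioo_subset_Icc_self)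
    have hne : (𝓝[Ioo 0 t] t).NeBot := by
      rw [← mem_closure_iff_nhdsWithin_neBot, closure_Ioo hT.ne]
      exact right_mem_Icc.2 hT.le
    have l1 := (tendsto_convolution ω γ hρ hα hT (hslice Ft ct)).add
      ((hlim _ hvc).mul (hlim _ cx))
    have l2 := (hlim _ cxx).add (hlim _ hf)
    refine tendsto_nhds_unique (l1.congr' ?_) l2
    filter_upwards [self_mem_nhdsWithin] with s hs
    exact hinner s hs
  · exact hinner t ⟨ht.1, htT⟩

include hL hT hv in
/-- Consistency of the difference scheme. -/
lemma exists_consistency_bound (hρ : 0 < ρ) (hα : 0 < α ∧ α < 1)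
    (hf : ContinuousOn (fun p : ℝ × ℝ => f p.1 p.2) (Icc 0 L ×ˢ Icc 0 T))
    (hsmooth : ContDiffOn ℝ 4 (fun p : ℝ × ℝ => v p.1 p.2) (Icc 0 L ×ˢ Icc 0 T)) :
    ∃ K, 0 < K ∧ ∀ N M : ℕ, 1 ≤ M →
      ∀ k ∈ Finset.Icc 1 N, ∀ i ∈ Finset.Icc 1 (M - 1),
      |discreteCP ρ α ω γ (T / N) (fun j => v (i * (L / M)) (j * (T / N))) k
        + 1 / (6 * (L / M)) * convection (fun l => v (l * (L / M)) (k * (T / N))) i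
        - secondDiff (L / M) (fun l => v (l * (L / M)) (k * (T / N))) i
        - f (i * (L / M)) (k * (T / N))| ≤ K * ((T / N) ^ (2 - α) + (L / M) ^ 2) := by
  obtain ⟨Fx, Fxx, K₁, cx, cxx, px, pxx, hK₁, est₁⟩ := exists_spatial_estimates hL hT hsmooth
  -- `Δ(v²)` is expanded as a central difference of `v²`; its `4h v v_x` and the `2h v v_x` of `v
  -- Δv` make up the `6h` of the scheme.
  obtain ⟨Sx, Sxx, K₂, -, -, psx, -, hK₂, est₂⟩ := exists_spatial_estimates hL hT
    (F := fun p => v p.1 p.2 ^ 2) (hsmooth.pow 2)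
  obtain ⟨-, Ft, -, ct, -, pt⟩ := exists_partials hL hT (m := 3) hsmooth (by norm_num)
  obtain ⟨-, Ftt, -, ctt, -, ptt⟩ := exists_partials hL hT (m := 2) ct (by norm_num)
  obtain ⟨B, hB, hBtt⟩ := exists_abs_le_on_rectangle ctt.continuousOn
  obtain ⟨V, hV, hVb⟩ := exists_abs_le_on_rectangle hsmooth.continuousOn
  obtain ⟨K₀, hK₀, trunc⟩ := exists_truncation_bound ω γ hρ hα hT
  refine ⟨K₀ * B + (V * K₁ + K₂ + K₁), by positivity, fun N M hM k hk i hi => ?_⟩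
  obtain ⟨hk1, hkN⟩ := Finset.mem_Icc.1 hk
  obtain ⟨hi1, hiM⟩ := Finset.mem_Icc.1 hi
  have hN1 : 1 ≤ N := hk1.trans hkN
  have hMpos : (0 : ℝ) < M := by exact_mod_cast hM
  have hNpos : (0 : ℝ) < N := by exact_mod_cast hN1
  set τ := T / N with hτdef
  set h := L / M with hhdef
  have hh : 0 < h := by positivity
  have hτ : 0 < τ := by positivity
  have hkpos : (0 : ℝ) < k := by exact_mod_cast hk1
  have ht : (k : ℝ) * τ ∈ Ioc 0 T := ⟨by positivity, (node_mem_Icc hT.le hN1 hkN).2⟩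
  have ht' := Ioc_subset_Icc_self ht
  have hip : ((i + 1 : ℕ) : ℝ) * h = i * h + h := by push_cast; ring
  have him : ((i - 1 : ℕ) : ℝ) * h = i * h - h := by
    rw [Nat.cast_sub hi1]; push_cast; ring
  have hxl : 0 ≤ i * h - h := by rw [← him]; positivity
  have hxr : i * h + h ≤ L := by rw [← hip]; exact (node_mem_Icc hL.le hM (by omega)).2
  have hx : (i : ℝ) * h ∈ Ioo 0 L := ⟨by linarith, by linarith⟩
  have hx' := Ioo_subset_Icc_self hx
  have e1 := trunc B (fun t => v (i * h) t) (fun t => Ft (i * h, t)) hB.le (pt _ hx')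
    (ptt.lipschitz hBtt hx') N k hk1 hkN
  have e2 := convolution_equation hT hv hρ hα hf hsmooth.continuousOn cx cxx ct.continuousOn
    px pxx pt hx ht
  obtain ⟨e3, e4⟩ := est₁ (k * τ) ht' (i * h) h hh hxl hxr
  obtain ⟨e5, -⟩ := est₂ (k * τ) ht' (i * h) h hh hxl hxr
  have e6 : Sx (i * h, k * τ) = 2 * v (i * h) (k * τ) * Fx (i * h, k * τ) := by
    rw [← (psx.hasDerivAt hx ht').deriv]
    refine (((px.hasDerivAt hx ht').pow 2).congr_deriv ?_).deriv
    simp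
  have e7 := hVb _ hx' _ ht'
  simp only at e3 e4 e5 e7
  rw [e6] at e5
  have hconv : 1 / (6 * h) * convection (fun l => v (l * h) (k * τ)) i
        - v (i * h) (k * τ) * Fx (i * h, k * τ)
      = v (i * h) (k * τ) / (6 * h) * (v (i * h + h) (k * τ) - v (i * h - h) (k * τ)
          - 2 * h * Fx (i * h, k * τ))
        + 1 / (6 * h) * (v (i * h + h) (k * τ) ^ 2 - v (i * h - h) (k * τ) ^ 2
          - 2 * h * (2 * v (i * h) (k * τ) * Fx (i * h, k * τ))) := by
    simp only [convection, centralDiff, hip, him]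
    field_simp
    ring
  have hconv_le : |1 / (6 * h) * convection (fun l => v (l * h) (k * τ)) i
        - v (i * h) (k * τ) * Fx (i * h, k * τ)| ≤ (V * K₁ + K₂) * h ^ 2 := by
    rw [hconv]
    refine (abs_add_le _ _).trans ?_
    rw [abs_mul, abs_mul, abs_div, abs_of_pos (by positivity : 0 < 6 * h),
      abs_of_pos (by positivity : 0 < 1 / (6 * h))]
    calc _ ≤ V / (6 * h) * (K₁ * h ^ 3) + 1 / (6 * h) * (K₂ * h ^ 3) := by gcongr
      _ = (V * K₁ + K₂) * h ^ 2 / 6 := by field_simp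
      _ ≤ (V * K₁ + K₂) * h ^ 2 := by
        have : 0 ≤ (V * K₁ + K₂) * h ^ 2 := by positivity
        linarith
  have hsec : |secondDiff h (fun l => v (l * h) (k * τ)) i - Fxx (i * h, k * τ)|
      ≤ K₁ * h ^ 2 := by
    have : secondDiff h (fun l => v (l * h) (k * τ)) i - Fxx (i * h, k * τ)
        = (v (i * h + h) (k * τ) - 2 * v (i * h) (k * τ) + v (i * h - h) (k * τ)
          - h ^ 2 * Fxx (i * h, k * τ)) / h ^ 2 := by
      simp only [secondDiff, hip, him]
      field_simp
    rw [this, abs_div, abs_of_pos (by positivity : 0 < h ^ 2), div_le_iff₀ (by positivity)]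
    linarith
  have hτα : 0 < τ ^ (2 - α) := by positivity
  have hc : (K₀ * B + (V * K₁ + K₂ + K₁)) * (τ ^ (2 - α) + h ^ 2)
      = K₀ * B * τ ^ (2 - α) + (V * K₁ + K₂) * h ^ 2 + K₁ * h ^ 2
        + (K₀ * B * h ^ 2 + (V * K₁ + K₂ + K₁) * τ ^ (2 - α)) := by ring
  have hc0 : 0 ≤ K₀ * B * h ^ 2 + (V * K₁ + K₂ + K₁) * τ ^ (2 - α) := by positivity
  rw [abs_le] at e1 hconv_le hsec ⊢
  constructor <;> linarith [e1.1, e1.2, hconv_le.1, hconv_le.2, hsec.1, hsec.2]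

lemma abs_sub_le_of_deriv_bound {C₀ : ℝ} {n : WithTop ℕ∞} (hn : n ≠ 0)
    (hsmooth : ContDiffOn ℝ n (fun p : ℝ × ℝ => v p.1 p.2) (Icc 0 L ×ˢ Icc 0 T))
    (hC₀ : ∀ x ∈ Ioo 0 L, ∀ t ∈ Icc 0 T, |deriv (fun y => v y t) x| ≤ C₀) {x y t : ℝ}
    (hx : x ∈ Icc 0 L) (hy : y ∈ Icc 0 L) (hxy : x < y) (ht : t ∈ Icc 0 T) :
    |v y t - v x t| ≤ (y - x) * C₀ := by
  have hslice : ContDiffOn ℝ n (fun z => v z t) (Icc 0 L) :=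
    hsmooth.comp (f := fun z => (z, t)) (by fun_prop) fun z hz => ⟨hz, ht⟩
  have hsub : Icc x y ⊆ Icc 0 L := Icc_subset_Icc hx.1 hy.2
  obtain ⟨ξ, hξ, e⟩ := exists_deriv_eq_slope (fun z => v z t) hxy
    (hslice.continuousOn.mono hsub) ((hslice.differentiableOn hn).mono
      (Ioo_subset_Icc_self.trans hsub))
  have hξL : ξ ∈ Ioo 0 L := ⟨hx.1.trans_lt hξ.1, hξ.2.trans_le hy.2⟩
  have h1 := hC₀ ξ hξL t ht
  rw [e, abs_div, abs_of_pos (sub_pos.2 hxy), div_le_iff₀ (sub_pos.2 hxy)] at h1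
  linarith

include hL hT hv in
/-- The error estimate on meshes for which the weighted Volterra operator is coercive. -/
lemma errorSq_le_of_coercive {C₀ K q : ℝ} {N M : ℕ}
    (hsmooth : ContDiffOn ℝ 4 (fun p : ℝ × ℝ => v p.1 p.2) (Icc 0 L ×ˢ Icc 0 T))
    (hC₀ : ∀ x ∈ Ioo 0 L, ∀ t ∈ Icc 0 T, |deriv (fun y => v y t) x| ≤ C₀)
    (hN : 1 ≤ N) (hM : 1 ≤ M) (hq : 0 < q) (hq1 : q ≤ 1)
    (hK : ∀ k ∈ Finset.Icc 1 N, ∀ i ∈ Finset.Icc 1 (M - 1),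
      |discreteCP ρ α ω γ (T / N) (fun j => v (i * (L / M)) (j * (T / N))) k
        + 1 / (6 * (L / M)) * convection (fun l => v (l * (L / M)) (k * (T / N))) i
        - secondDiff (L / M) (fun l => v (l * (L / M)) (k * (T / N))) i
        - f (i * (L / M)) (k * (T / N))| ≤ K)
    (hco : C₀ / 2 + 1 ≤ cpWeight ρ α ω γ (T / N) 1 - ∑ n ∈ Finset.Icc 1 (N - 1),
        |cpWeight ρ α ω γ (T / N) n - cpWeight ρ α ω γ (T / N) (n + 1)| * q ^ n)
    {u : ℕ → ℕ → ℝ} (hu : IsSchemeSolution ρ α ω γ L T f φ N M u) :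
    q ^ (2 * N) * errorSq L T N M v u ≤ T * L * (K ^ 2 / 4) := by
  have hMpos : (0 : ℝ) < M := by exact_mod_cast hM
  have hNpos : (0 : ℝ) < N := by exact_mod_cast hN
  have hh : 0 < L / M := by positivity
  have hbd := boundary_zero hT hv hsmooth hL
  have hML := cast_mul_div_cancel L hM
  have hNT := cast_mul_div_cancel T hN
  have key := sum_energy_le (h := L / M) (c := C₀ / 2) (η := 1) (R := K) (q := q)
    (b₀ := cpWeight ρ α ω γ (T / N) 1)
    (b := fun n => cpWeight ρ α ω γ (T / N) n - cpWeight ρ α ω γ (T / N) (n + 1))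
    hh one_pos hq hq1 (M := M) (N := N) (y := gridError (T / N) (L / M) v u) hco
    (fun k hk => by
      obtain ⟨hk1, hkN⟩ := Finset.mem_Icc.1 hk
      have ht := node_mem_Icc hT.le hN hkN
      refine step_energy (a := fun i => v (i * (L / M)) (k * (T / N))) (u := u k)
        (r := fun i => discreteCP ρ α ω γ (T / N) (fun j => v (i * (L / M)) (j * (T / N))) k
          + 1 / (6 * (L / M)) * convection (fun l => v (l * (L / M)) (k * (T / N))) i
          - secondDiff (L / M) (fun l => v (l * (L / M)) (k * (T / N))) i
          - f (i * (L / M)) (k * (T / N)))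
        hh hM ?_ ?_ (fun i hi => ?_) (hK k hk) (fun i hi => ?_)
      · rw [(hu.boundary k hkN).1, Nat.cast_zero, zero_mul, (hbd _ ht).1]
      · rw [(hu.boundary k hkN).2, hML, (hbd _ ht).2]
      · have e : ((i + 1 : ℕ) : ℝ) * (L / M) - i * (L / M) = L / M := by push_cast; ring
        have := abs_sub_le_of_deriv_bound (by norm_num) hsmooth hC₀
          (node_mem_Icc (i := i) hL.le hM hi.le) (node_mem_Icc (i := i + 1) hL.le hM hi)
          (by linarith) ht
        rwa [e] at this
      · have h1 := hu.equation k hk i hi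
        obtain ⟨hi1, hiM⟩ := Finset.mem_Icc.1 hi
        have hxi : (i : ℝ) * (L / M) ∈ Ioo 0 L := by
          have hipos : (0 : ℝ) < i := by exact_mod_cast hi1
          have e : ((i + 1 : ℕ) : ℝ) * (L / M) = i * (L / M) + L / M := by push_cast; ring
          have := (node_mem_Icc (i := i + 1) hL.le hM (by omega)).2
          exact ⟨by positivity, by linarith⟩
        -- The initial error vanishes at interior nodes, which removes the `a_k y^0` term.
        have h0 : v (i * (L / M)) ((0 : ℕ) * (T / N)) = u 0 i := by
          rw [hu.initial i hi, Nat.cast_zero, zero_mul, hv.initial _ hxi]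
        have h2 : cpWeight ρ α ω γ (T / N) 1 * gridError (T / N) (L / M) v u k i
            - ∑ j ∈ Finset.Icc 1 (k - 1), (cpWeight ρ α ω γ (T / N) (k - j)
              - cpWeight ρ α ω γ (T / N) (k - j + 1)) * gridError (T / N) (L / M) v u j i
            = discreteCP ρ α ω γ (T / N) (fun j => v (i * (L / M)) (j * (T / N))) k
              - discreteCP ρ α ω γ (T / N) (fun j => u j i) k := by
          rw [discreteCP_eq, discreteCP_eq, h0]
          simp only [gridError, mul_sub, Finset.sum_sub_distrib]
          ring
        rw [h2]
        change _ + 1 / (6 * (L / M)) * convection (u k) i = _ at h1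
        have h3 : secondDiff (L / M) (fun l => v (l * (L / M)) (k * (T / N)) - u k l) i
            = secondDiff (L / M) (fun l => v (l * (L / M)) (k * (T / N))) i
              - secondDiff (L / M) (u k) i := by
          simp only [secondDiff]; ring
        rw [h3]
        linear_combination -h1)
  rw [hML, mul_one] at key
  rw [errorSq]
  calc _ = T / N * (q ^ (2 * N) * ∑ k ∈ Finset.Icc 1 N,
        gridNormSq (L / M) M (backwardDiff (L / M) (gridError (T / N) (L / M) v u k))) := by ring
    _ ≤ T / N * (N * (L * (K ^ 2 / 4))) := by gcongr
    _ = T * L * (K ^ 2 / 4) := by field_simp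

include hL hT hv in
/-- For a fixed number of time steps the error is bounded uniformly in the spatial mesh. -/
lemma exists_errorSq_bound {C₀ : ℝ}
    (hf : ContinuousOn (fun p : ℝ × ℝ => f p.1 p.2) (Icc 0 L ×ˢ Icc 0 T))
    (hsmooth : ContDiffOn ℝ 4 (fun p : ℝ × ℝ => v p.1 p.2) (Icc 0 L ×ˢ Icc 0 T))
    (hC₀ : ∀ x ∈ Ioo 0 L, ∀ t ∈ Icc 0 T, |deriv (fun y => v y t) x| ≤ C₀) (N : ℕ) :
    ∃ C, 0 ≤ C ∧ ∀ M : ℕ, 1 ≤ N → 1 ≤ M → 0 < coeff ρ α ω γ (T / N) 1 →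
      ∀ u : ℕ → ℕ → ℝ, IsSchemeSolution ρ α ω γ L T f φ N M u → errorSq L T N M v u ≤ C := by
  -- The constant must be fixed before `N ≥ 1` and `a_1 > 0` are known; where they fail, `0` serves
  -- vacuously.
  by_cases hc : 1 ≤ N ∧ 0 < coeff ρ α ω γ (T / N) 1
  swap
  · exact ⟨0, le_rfl, fun M h1 _ h2 => absurd ⟨h1, h2⟩ hc⟩
  obtain ⟨hN, ha⟩ := hc
  have hNpos : (0 : ℝ) < N := by exact_mod_cast hN
  have hτ : 0 < T / N := by positivity
  have hA : 0 < cpWeight ρ α ω γ (T / N) 1 := div_pos ha (by positivity)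
  obtain ⟨q, hq, hq1, hco⟩ := exists_weight_of_pos hA N
  obtain ⟨V, hV, hVb⟩ := exists_abs_le_on_rectangle hsmooth.continuousOn
  obtain ⟨Φ, hΦ, hΦb⟩ := exists_abs_le_on_rectangle hf
  set S := ∑ n ∈ Finset.Icc 1 N, |cpWeight ρ α ω γ (T / N) n|
  have hS : 0 ≤ S := Finset.sum_nonneg fun _ _ => abs_nonneg _
  set E := N * (L * ((Φ + S * V) ^ 2 / (4 * (cpWeight ρ α ω γ (T / N) 1 / 2)))) with hE
  have hE0 : 0 ≤ E := by positivity
  refine ⟨T / N * (2 * (N * (L * C₀ ^ 2)) + 2 * (E / q ^ (2 * N))), by positivity,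
    fun M _ hM _ u hu => ?_⟩
  have hMpos : (0 : ℝ) < M := by exact_mod_cast hM
  have hh : 0 < L / M := by positivity
  have hML := cast_mul_div_cancel L hM
  -- The energy of `u` itself, as the difference from the zero grid function: there the convection
  -- costs nothing (`c = 0`), and half of `A_1` suffices for `η`. The initial term `A_k u^0` joins
  -- the source, bounded through `φ = v(·,0)`.
  have key := sum_energy_le (h := L / M) (c := 0) (η := cpWeight ρ α ω γ (T / N) 1 / 2)
    (R := Φ + S * V) (q := q) (b₀ := cpWeight ρ α ω γ (T / N) 1)
    (b := fun n => cpWeight ρ α ω γ (T / N) n - cpWeight ρ α ω γ (T / N) (n + 1))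
    hh (by positivity) hq hq1 (M := M) (N := N) (y := fun k i => 0 - u k i) hco
    (fun k hk => by
      obtain ⟨hk1, hkN⟩ := Finset.mem_Icc.1 hk
      have ht := node_mem_Icc hT.le hN hkN
      have := step_energy (C := 0) (R := Φ + S * V) (a := fun _ => 0) (u := u k)
        (d := fun i => cpWeight ρ α ω γ (T / N) 1 * (0 - u k i)
            - ∑ j ∈ Finset.Icc 1 (k - 1), (cpWeight ρ α ω γ (T / N) (k - j)
              - cpWeight ρ α ω γ (T / N) (k - j + 1)) * (0 - u j i))
        (r := fun i => -f (i * (L / M)) (k * (T / N)) - cpWeight ρ α ω γ (T / N) k * u 0 i)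
        hh hM (hu.boundary k hkN).1.symm (hu.boundary k hkN).2.symm (fun i hi => by simp)
        (fun i hi => ?_) (fun i hi => ?_)
      · rwa [zero_div] at this
      · obtain ⟨hi1, hiM⟩ := Finset.mem_Icc.1 hi
        have hxi : (i : ℝ) * (L / M) ∈ Ioo 0 L := by
          have hipos : (0 : ℝ) < i := by exact_mod_cast hi1
          have e : ((i + 1 : ℕ) : ℝ) * (L / M) = i * (L / M) + L / M := by push_cast; ring
          have := (node_mem_Icc (i := i + 1) hL.le hM (by omega)).2
          exact ⟨by positivity, by linarith⟩
        have h0 : |u 0 i| ≤ V := by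
          rw [hu.initial i hi, ← hv.initial _ hxi]
          exact hVb _ (Ioo_subset_Icc_self hxi) 0 (left_mem_Icc.2 hT.le)
        have h1 : |cpWeight ρ α ω γ (T / N) k| ≤ S :=
          Finset.single_le_sum (f := fun n => |cpWeight ρ α ω γ (T / N) n|)
            (fun _ _ => abs_nonneg _) hk
        have h2 := hΦb _ (Ioo_subset_Icc_self hxi) _ ht
        calc |-f (i * (L / M)) (k * (T / N)) - cpWeight ρ α ω γ (T / N) k * u 0 i|
            ≤ |-f (i * (L / M)) (k * (T / N))| + |cpWeight ρ α ω γ (T / N) k * u 0 i| :=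
              abs_sub _ _
          _ ≤ Φ + S * V := by
              rw [abs_neg, abs_mul]
              exact add_le_add h2 (mul_le_mul h1 h0 (abs_nonneg _) hS)
      · have h1 := hu.equation k hk i hi
        change _ + 1 / (6 * (L / M)) * convection (u k) i = _ at h1
        rw [discreteCP_eq] at h1
        have h3 : secondDiff (L / M) (fun l => 0 - u k l) i = -secondDiff (L / M) (u k) i := by
          simp only [secondDiff]; ring
        have h4 : convection (fun _ => 0) i = 0 := by simp [convection, centralDiff]
        rw [h3, h4]
        simp only [zero_sub, mul_neg, Finset.sum_neg_distrib]
        linear_combination -h1)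
  rw [hML] at key
  have hgrid : ∀ k ∈ Finset.Icc 1 N,
      gridNormSq (L / M) M (backwardDiff (L / M) (gridError (T / N) (L / M) v u k))
      ≤ 2 * (L * C₀ ^ 2) + 2 * gridNormSq (L / M) M (backwardDiff (L / M) fun i => 0 - u k i) := by
    intro k hk
    have ht := node_mem_Icc hT.le hN (Finset.mem_Icc.1 hk).2
    have hsum : ∑ i ∈ Finset.Icc 1 M, L / M * C₀ ^ 2 = L * C₀ ^ 2 := by
      rw [Finset.sum_const, Nat.card_Icc, Nat.add_sub_cancel, nsmul_eq_mul, ← mul_assoc, hML]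
    rw [← hsum, gridNormSq, gridNormSq, Finset.mul_sum, Finset.mul_sum,
      ← Finset.sum_add_distrib]
    refine Finset.sum_le_sum fun i hi => ?_
    obtain ⟨hi1, hiM⟩ := Finset.mem_Icc.1 hi
    obtain ⟨l, rfl⟩ : ∃ l, i = l + 1 := ⟨i - 1, by omega⟩
    have e : ((l + 1 : ℕ) : ℝ) * (L / M) - l * (L / M) = L / M := by push_cast; ring
    have hd := abs_sub_le_of_deriv_bound (by norm_num) hsmooth hC₀
      (node_mem_Icc (i := l) hL.le hM (by omega)) (node_mem_Icc (i := l + 1) hL.le hM hiM)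
      (by linarith) ht
    rw [e] at hd
    have hd2 : ((v ((l + 1 : ℕ) * (L / M)) (k * (T / N)) - v (l * (L / M)) (k * (T / N)))
        / (L / M)) ^ 2 ≤ C₀ ^ 2 := by
      refine sq_le_sq' ?_ ?_
      · rw [le_div_iff₀ hh]; linarith [(abs_le.1 hd).1]
      · rw [div_le_iff₀ hh]; linarith [(abs_le.1 hd).2]
    have hs : backwardDiff (L / M) (gridError (T / N) (L / M) v u k) (l + 1)
        = (v ((l + 1 : ℕ) * (L / M)) (k * (T / N)) - v (l * (L / M)) (k * (T / N))) / (L / M)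
          + backwardDiff (L / M) (fun i => 0 - u k i) (l + 1) := by
      simp only [backwardDiff, gridError, Nat.add_sub_cancel]
      ring
    rw [hs]
    refine le_trans (mul_le_mul_of_nonneg_left (add_sq_le) hh.le) ?_
    have := mul_le_mul_of_nonneg_left hd2 hh.le
    linarith
  rw [errorSq]
  refine mul_le_mul_of_nonneg_left ((Finset.sum_le_sum hgrid).trans ?_) hτ.le
  rw [Finset.sum_add_distrib, Finset.sum_const, Nat.card_Icc, Nat.add_sub_cancel, nsmul_eq_mul,
    ← Finset.mul_sum]
  have h5 := (le_div_iff₀' (by positivity : 0 < q ^ (2 * N))).2 key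
  linarith

end Solution

end CPBurgers

end

/-! ### Assembly: fine and coarse time meshes. -/

theorem mainTheorem2 (ρ α ω γ L T : ℝ) (hρ : 0 < ρ) (hα : 0 < α ∧ α < 1)
    (hL : 0 < L) (hT : 0 < T) (f : ℝ → ℝ → ℝ) (φ : ℝ → ℝ)
    (hf : ContinuousOn (fun p : ℝ × ℝ => f p.1 p.2) (Set.Icc 0 L ×ˢ Set.Icc 0 T))
    (v : ℝ → ℝ → ℝ)
    (hsmooth : ContDiffOn ℝ 4 (fun p : ℝ × ℝ => v p.1 p.2) (Set.Icc 0 L ×ˢ Set.Icc 0 T))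
    (hv : CPBurgers.IsExactSolution ρ α ω γ L T f φ v)
    (C₀ : ℝ)
    (hC₀ : ∀ x ∈ Set.Ioo 0 L, ∀ t ∈ Set.Icc 0 T, |deriv (fun y => v y t) x| ≤ C₀) :
    ∃ C : ℝ, 0 < C ∧ ∀ N M : ℕ, 1 ≤ N → 1 ≤ M →
      0 < CPBurgers.coeff ρ α ω γ (T / N) 1 →
      0 < CPBurgers.coeff ρ α ω γ (T / N) N / (2 * (T / N) ^ α) - C₀ / 2 →
      ∀ u : ℕ → ℕ → ℝ, CPBurgers.IsSchemeSolution ρ α ω γ L T f φ N M u →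
        CPBurgers.errorSq L T N M v u ≤ C * ((T / N) ^ (2 - α) + (L / M) ^ 2) ^ 2 ∧
        Real.sqrt (CPBurgers.errorSq L T N M v u)
          ≤ C * ((T / N) ^ (2 - α) + (L / M) ^ 2) := by
  obtain ⟨K, hK, hcons⟩ := CPBurgers.exists_consistency_bound hL hT hv hρ hα hf hsmooth
  obtain ⟨N₀, θ, hθ, hfine⟩ := CPBurgers.exists_weight_of_fine ω γ hρ hα (C₀ / 2 + 1) hT
  choose c hc0 hc using CPBurgers.exists_errorSq_bound hL hT hv hf hsmooth hC₀
  set C₁ := T * L * (K ^ 2 / 4) / θ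
  -- One constant covers the finitely many coarse `N`. The term `N = 0` is a division by zero, equal
  -- to `0`.
  set C₂ := ∑ N ∈ Finset.range N₀, c N / ((T / N) ^ (2 - α)) ^ 2
  have hC₁ : 0 ≤ C₁ := by positivity
  have hC₂0 : ∀ N : ℕ, 0 ≤ c N / ((T / N) ^ (2 - α)) ^ 2 := fun N =>
    div_nonneg (hc0 N) (by positivity)
  have hC₂ : 0 ≤ C₂ := Finset.sum_nonneg fun N _ => hC₂0 N
  -- The `+ 1` makes the constant `C ≥ 1`, so that `C ≤ C²` and the bound survives the square root
  -- with the same `C`.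
  refine ⟨C₁ + C₂ + 1, by positivity, fun N M hN hM ha _ u hu => ?_⟩
  have hNpos : (0 : ℝ) < N := by exact_mod_cast hN
  have hMpos : (0 : ℝ) < M := by exact_mod_cast hM
  have hτ : 0 < (T / N) ^ (2 - α) := by positivity
  set X := (T / N) ^ (2 - α) + (L / M) ^ 2 with hX
  have hX0 : 0 ≤ X := by positivity
  have hmain : CPBurgers.errorSq L T N M v u ≤ (C₁ + C₂ + 1) * X ^ 2 := by
    by_cases hNN : N₀ ≤ N
    · obtain ⟨q, hq, hq1, hθq, hco⟩ := hfine N hNN hN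
      have h1 := CPBurgers.errorSq_le_of_coercive hL hT hv hsmooth hC₀ hN hM hq hq1
        (hcons N M hM) hco hu
      have h0 : 0 ≤ CPBurgers.errorSq L T N M v u :=
        mul_nonneg (by positivity)
          (Finset.sum_nonneg fun k _ => CPBurgers.gridNormSq_nonneg (by positivity) M _)
      have h2 : CPBurgers.errorSq L T N M v u ≤ C₁ * X ^ 2 := by
        have h3 : C₁ * X ^ 2 = T * L * ((K * X) ^ 2 / 4) / θ := by
          simp only [C₁]; ring
        rw [h3, le_div_iff₀ hθ, mul_comm]
        exact (mul_le_mul_of_nonneg_right hθq h0).trans h1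
      nlinarith [sq_nonneg X]
    · have h1 := hc N M hN hM ha u hu
      have h2 : c N / ((T / N) ^ (2 - α)) ^ 2 ≤ C₂ :=
        Finset.single_le_sum (f := fun N : ℕ => c N / ((T / N) ^ (2 - α)) ^ 2)
          (fun N _ => hC₂0 N) (Finset.mem_range.2 (not_le.1 hNN))
      rw [div_le_iff₀ (by positivity)] at h2
      have h3 : ((T / N) ^ (2 - α)) ^ 2 ≤ X ^ 2 :=
        pow_le_pow_left₀ hτ.le (by rw [hX]; linarith [sq_nonneg (L / (M : ℝ))]) 2
      nlinarith [mul_le_mul_of_nonneg_left h3 hC₂, sq_nonneg X]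
  refine ⟨hmain, Real.sqrt_le_iff.2 ⟨by positivity, hmain.trans ?_⟩⟩
  rw [mul_pow]
  refine mul_le_mul_of_nonneg_right ?_ (sq_nonneg X)
  nlinarith
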